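/- Let $\mathbf k$ be a field, $m\ge 2$, and let $I_m\subseteq \mathbf k[x_{11},x_{12},\dots,x_{m1},x_{m2}]$ be the monomial ideal $$I_m=\langle x_{11}^3x_{12},\dots,x_{m1}^3x_{m2},\; x_{11}^2x_{21}x_{22},\dots,x_{(m-1)1}^2x_{m1}x_{m2},\; x_{m1}^2x_{11}x_{12}\rangle .$$ For a monomial ideal $J$ let $G(J)$ be its set of minimal monomial generators and $a_i$ the largest exponent of the variable $x_i$ in $G(J)$; the polarization $J^P$ is the squarefree ideal, in the variables $x_{i,j}$ with $1\le j\le a_i$, generated by the monomials $\prod_i x_{i,1}\cdots x_{i,b_i}$ for $\prod_i x_i^{b_i}\in G(J)$. The ideal $J$ belongs to the polarity class of $I_m$ if some bijection between the variables of $I_m^P$ and those of $J^P$ maps $G(I_m^P)$ onto $G(J^P)$. Let $J\subseteq S=\mathbf k[y_1,\dots,y_n]$ be any monomial ideal in the polarity class of $I_m$. Then: 1. $\operatorname{reg}(S/J)=2m$, equivalently $\operatorname{reg}(J)=2m+1$, where $\operatorname{reg}(N)=\max\{|\mu|-i : \beta_{i,\mu}(N)\neq 0\}$ for a multigraded $S$-module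 $N$ with multigraded Betti numbers $\beta_{i,\mu}(N)$; 2. the projective dimension of $J$ as an $S$-module is $\operatorname{projdim}(J)=\lfloor m/2\rfloor+m-1$; 3. the minimal multigraded free resolution of $J$ is an iterated mapping cone resolution: for a suitable ordering $f_1,\dots,f_r$ of $G(J)$ it is obtained recursively, starting from the zero complex for the zero ideal, by attaching to an ideal $\langle f_1,\dots,f_s\rangle$ with ordered minimal monomial generators the mapping cone of a lift, homogeneous of multidegree $0$, of the inclusion $\langle f_1,\dots,f_{s-1}\rangle\cap\langle f_s\rangle\to\langle f_1,\dots,f_{s-1}\rangle\oplus\langle f_s\rangle$ to the complexes $\widetilde F\to F'\oplus S(-f_s)$, where $F'$ and $\widetilde F$ are iterated mapping cones for $\langle f_1,\dots,f_{s-1}\rangle$ (with the same ordering) and for $\langle f_1,\dots,f_{s-1}\rangle\cap\langle f_s\rangle$ (with some ordering of its minimal monomial generators). -/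

import Mathlib

open MvPolynomial

/-! ## Monomial ideals, minimal generators, polarization -/

section Polarization

variable {k : Type*} [Field k] {σ : Type*} {τ : Type*}

/-- The ideal generated by the monomials with exponent vectors in `A`. -/
noncomputable def monomialSpan (k : Type*) [Field k] {σ : Type*} (A : Set (σ →₀ ℕ)) :
    Ideal (MvPolynomial σ k) :=
  Ideal.span ((fun μ => monomial μ (1 : k)) '' A)

/-- A monomial ideal is an ideal generated by monomials. -/
def IsMonomialIdeal (I : Ideal (MvPolynomial σ k)) : Prop :=
  ∃ A : Set (σ →₀ ℕ), I = monomialSpan k A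

/-- The exponent vectors of the minimal monomial generating set `G(I)`: the monomials of `I` that
are minimal for divisibility. -/
def minGens (I : Ideal (MvPolynomial σ k)) : Set (σ →₀ ℕ) :=
  {μ | Minimal (fun ν : σ →₀ ℕ => monomial ν (1 : k) ∈ I) μ}

/-- The maximal exponent of the variable `i` in the minimal generators of `I`. -/
noncomputable def maxExp (I : Ideal (MvPolynomial σ k)) (i : σ) : ℕ :=
  sSup ((fun μ : σ →₀ ℕ => μ i) '' minGens I)

/-- The variables `x_{i,1}, …, x_{i,a_i}` of the polarization, with `a_i = maxExp I i`. -/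
abbrev PolVar (I : Ideal (MvPolynomial σ k)) : Type _ := Σ i : σ, Fin (maxExp I i)

/-- The polarization of an exponent vector: `x_{i,j}` occurs, to the power one, exactly for the
first `μ i` of the copies of `x_i`. -/
noncomputable def polExp [Finite σ] (I : Ideal (MvPolynomial σ k)) (μ : σ →₀ ℕ) :
    PolVar I →₀ ℕ :=
  Finsupp.equivFunOnFinite.symm fun p => if (p.2 : ℕ) < μ p.1 then 1 else 0

/-- The polarization `I^P`. -/
noncomputable def polarization [Finite σ] (I : Ideal (MvPolynomial σ k)) :
    Ideal (MvPolynomial (PolVar I) k) :=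
  monomialSpan k (polExp I '' minGens I)

/-- `I` and `J` are in the same polarity class: a bijection of the variables takes `G(I^P)` onto
`G(J^P)`. -/
def SamePolarityClass [Finite σ] [Finite τ] (I : Ideal (MvPolynomial σ k))
    (J : Ideal (MvPolynomial τ k)) : Prop :=
  ∃ e : PolVar I ≃ PolVar J,
    Finsupp.mapDomain e '' minGens (polarization I) = minGens (polarization J)

/-- The ideal generated by `x_{i1}^3 x_{i2}` and `x_{i1}^2 x_{(i+1)1} x_{(i+1)2}` for `i` in
`Fin m`, with `i + 1` read cyclically. -/
noncomputable def diamondIdeal (k : Type*) [Field k] (m : ℕ) :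
    Ideal (MvPolynomial (Fin m × Fin 2) k) :=
  Ideal.span
    (Set.range (fun i : Fin m =>
        (X (i, 0) ^ 3 * X (i, 1) : MvPolynomial (Fin m × Fin 2) k)) ∪
     Set.range (fun i : Fin m =>
        (X (i, 0) ^ 2 * X (finRotate m i, 0) * X (finRotate m i, 1) :
          MvPolynomial (Fin m × Fin 2) k)))

end Polarization

/-! ## Multigraded free resolutions -/

section Resolutions

/-- `p`, as a map `S(-b) → S(-a)`, is homogeneous of multidegree `0`; that is, `p` is a scalar
multiple of the monomial with exponent `b - a` (and is `0` if `a ≤ b` fails). -/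
def MultiHom {k : Type*} [Field k] {σ : Type*} (p : MvPolynomial σ k) (a b : σ →₀ ℕ) : Prop :=
  ∀ ν ∈ p.support, ν + a = b

/-- A complex `⋯ → F_2 → F_1 → F_0 → M` of finitely generated multigraded free modules over
`S = k[σ]` and homogeneous maps, with an augmentation to a module `M` whose homogeneous components
are the `𝓜 μ`. The module `F_i` has the finite basis `B i` with multidegrees `deg i`, the
differential `F_{i+1} → F_i` is given by the matrix `D i`, and the augmentation by the images `ε b`
of the basis elements of `F_0`. -/
structure AugFreeComplex (k : Type*) [Field k] (σ : Type*) {M : Type*} [AddCommGroup M]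
    [Module (MvPolynomial σ k) M] (𝓜 : (σ →₀ ℕ) → AddSubgroup M) where
  B : ℕ → Type
  fin : ∀ i, Fintype (B i)
  deg : ∀ i, B i → (σ →₀ ℕ)
  D : ∀ i, Matrix (B i) (B (i + 1)) (MvPolynomial σ k)
  ε : B 0 → M
  D_hom : ∀ i a b, MultiHom (D i a b) (deg i a) (deg (i + 1) b)
  ε_hom : ∀ b, ε b ∈ 𝓜 (deg 0 b)
  D_comp : ∀ i, D i * D (i + 1) = 0
  ε_comp : ∀ b, ∑ a, D 0 a b • ε a = 0

attribute [instance] AugFreeComplex.fin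

variable {k : Type*} [Field k] {σ : Type*}

namespace AugFreeComplex

variable {M : Type*} [AddCommGroup M] [Module (MvPolynomial σ k) M]
  {𝓜 : (σ →₀ ℕ) → AddSubgroup M}

/-- The complex is a free resolution of the submodule `N` of `M`: the augmentation has image `N`,
and the augmented complex is exact in all other places. -/
def Resolves (F : AugFreeComplex k σ 𝓜) (N : Submodule (MvPolynomial σ k) M) : Prop :=
  Submodule.span (MvPolynomial σ k) (Set.range F.ε) = N ∧
  (∀ v : F.B 0 → MvPolynomial σ k, ∑ a, v a • F.ε a = 0 → ∃ w, v = (F.D 0).mulVec w) ∧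
  (∀ i, ∀ v : F.B (i + 1) → MvPolynomial σ k,
    (F.D i).mulVec v = 0 → ∃ w, v = (F.D (i + 1)).mulVec w)

/-- Minimality: each differential maps `F_{i+1}` into `𝔪 F_i`, where `𝔪` is the ideal generated by
the variables. -/
def IsMinimal (F : AugFreeComplex k σ 𝓜) : Prop :=
  ∀ i a b, F.D i a b ∈ Ideal.span (Set.range (X : σ → MvPolynomial σ k))

end AugFreeComplex

/-- The multigrading of the polynomial ring: the component of multidegree `μ` is `k x^μ`. -/
noncomputable def polyGrading (k : Type*) [Field k] (σ : Type*) (μ : σ →₀ ℕ) :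
    AddSubgroup (MvPolynomial σ k) :=
  (LinearMap.range (monomial μ : k →ₗ[k] MvPolynomial σ k)).toAddSubgroup

/-- The induced multigrading of `S ⧸ J`. -/
noncomputable def quotGrading (J : Ideal (MvPolynomial σ k)) (μ : σ →₀ ℕ) :
    AddSubgroup (MvPolynomial σ k ⧸ J) :=
  (polyGrading k σ μ).map (Ideal.Quotient.mk J).toAddMonoidHom

/-- The multigraded Betti number `β_{i,μ}(N)` is nonzero: in the minimal multigraded free
resolution of `N`, the `i`-th module has a basis element of multidegree `μ`. -/
def BettiNonzero {M : Type*} [AddCommGroup M] [Module (MvPolynomial σ k) M]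
    (𝓜 : (σ →₀ ℕ) → AddSubgroup M) (N : Submodule (MvPolynomial σ k) M)
    (i : ℕ) (μ : σ →₀ ℕ) : Prop :=
  ∃ F : AugFreeComplex k σ 𝓜, F.Resolves N ∧ F.IsMinimal ∧ ∃ b : F.B i, F.deg i b = μ

/-- The Castelnuovo–Mumford regularity `max {|μ| - i : β_{i,μ}(N) ≠ 0}` of the multigraded
module `N`, where `|μ|` is the total degree. -/
noncomputable def cmRegularity {M : Type*} [AddCommGroup M] [Module (MvPolynomial σ k) M]
    (𝓜 : (σ →₀ ℕ) → AddSubgroup M) (N : Submodule (MvPolynomial σ k) M) : ℤ :=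
  sSup {r : ℤ | ∃ i μ, BettiNonzero 𝓜 N i μ ∧ r = (μ.degree : ℤ) - i}

/-- The regularity of an ideal, as a module. -/
noncomputable def regIdeal (J : Ideal (MvPolynomial σ k)) : ℤ :=
  cmRegularity (polyGrading k σ) J

/-- The regularity of the quotient ring `S ⧸ J`, as a module. -/
noncomputable def regQuotient (J : Ideal (MvPolynomial σ k)) : ℤ :=
  cmRegularity (quotGrading J) (⊤ : Submodule (MvPolynomial σ k) (MvPolynomial σ k ⧸ J))

/-! ## Iterated mapping cones -/

/-- A chain map `F̃ → F' ⊕ S(-f)` of multidegree `0` (the second summand in homological degree `0`)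
that lifts `J̃ → J' ⊕ ⟨x^f⟩`, `a ↦ (a, -a)`. Here `F'` and `F̃` are augmented to `J'` and `J̃` inside
`S`; `φ` is the component into `F'`, and `-ψ` is the component into `S(-f)`. -/
structure ConeLift (F' Ft : AugFreeComplex k σ (polyGrading k σ)) (f : σ →₀ ℕ) where
  φ : ∀ i, Matrix (F'.B i) (Ft.B i) (MvPolynomial σ k)
  ψ : Ft.B 0 → MvPolynomial σ k
  φ_hom : ∀ i a b, MultiHom (φ i a b) (F'.deg i a) (Ft.deg i b)
  ψ_hom : ∀ b, MultiHom (ψ b) f (Ft.deg 0 b)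
  φ_comm : ∀ i, F'.D i * φ (i + 1) = φ i * Ft.D i
  φ_aug : ∀ b, ∑ a, φ 0 a b * F'.ε a = Ft.ε b
  ψ_aug : ∀ b, ψ b * monomial f (1 : k) = Ft.ε b

namespace ConeLift

variable {F' Ft : AugFreeComplex k σ (polyGrading k σ)} {f : σ →₀ ℕ}

def coneB (F' Ft : AugFreeComplex k σ (polyGrading k σ)) : ℕ → Type
  | 0 => F'.B 0 ⊕ Unit
  | i + 1 => F'.B (i + 1) ⊕ Ft.B i

instance coneFintype (F' Ft : AugFreeComplex k σ (polyGrading k σ)) : ∀ i, Fintype (coneB F' Ft i)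
  | 0 => inferInstanceAs (Fintype (F'.B 0 ⊕ Unit))
  | i + 1 => inferInstanceAs (Fintype (F'.B (i + 1) ⊕ Ft.B i))

def coneDeg (F' Ft : AugFreeComplex k σ (polyGrading k σ)) (f : σ →₀ ℕ) :
    ∀ i, coneB F' Ft i → (σ →₀ ℕ)
  | 0 => Sum.elim (F'.deg 0) (fun _ => f)
  | i + 1 => Sum.elim (F'.deg (i + 1)) (Ft.deg i)

noncomputable def coneD (φ : ConeLift F' Ft f) :
    ∀ i, Matrix (coneB F' Ft i) (coneB F' Ft (i + 1)) (MvPolynomial σ k)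
  | 0 => Matrix.fromBlocks (F'.D 0) (φ.φ 0) 0 (Matrix.of fun _ b => -φ.ψ b)
  | i + 1 => Matrix.fromBlocks (F'.D (i + 1)) (φ.φ (i + 1)) 0 (-Ft.D i)

noncomputable def coneε (F' Ft : AugFreeComplex k σ (polyGrading k σ)) (f : σ →₀ ℕ) :
    coneB F' Ft 0 → MvPolynomial σ k :=
  Sum.elim F'.ε (fun _ => monomial f (1 : k))

theorem multiHom_zero (a b : σ →₀ ℕ) : MultiHom (0 : MvPolynomial σ k) a b := by
  intro ν hν; simp at hν

theorem multiHom_neg {p : MvPolynomial σ k} {a b : σ →₀ ℕ} (h : MultiHom p a b) :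
    MultiHom (-p) a b := by
  intro ν hν; exact h ν (by simpa using hν)

theorem ψ_D (φ : ConeLift F' Ft f) (b : Ft.B 1) : ∑ a, φ.ψ a * Ft.D 0 a b = 0 := by
  have h : (∑ a, φ.ψ a * Ft.D 0 a b) * monomial f (1 : k) = 0 := by
    rw [← Ft.ε_comp b, Finset.sum_mul]
    refine Finset.sum_congr rfl fun a _ => ?_
    rw [← φ.ψ_aug a, smul_eq_mul]; ring
  rcases mul_eq_zero.1 h with h | h
  · exact h
  · exact absurd h (by simp)

/-- The mapping cone of `F̃ → F' ⊕ S(-f)`, augmented to `J' + ⟨x^f⟩` inside `S`. -/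
noncomputable def cone (φ : ConeLift F' Ft f) : AugFreeComplex k σ (polyGrading k σ) where
  B := coneB F' Ft
  fin := coneFintype F' Ft
  deg := coneDeg F' Ft f
  D := φ.coneD
  ε := coneε F' Ft f
  D_hom := by
    rintro (_ | i) (a | a) (b | b)
    · exact F'.D_hom 0 a b
    · exact φ.φ_hom 0 a b
    · exact multiHom_zero _ _
    · exact multiHom_neg (φ.ψ_hom b)
    · exact F'.D_hom (i + 1) a b
    · exact φ.φ_hom (i + 1) a b
    · exact multiHom_zero _ _
    · exact multiHom_neg (Ft.D_hom i a b)
  ε_hom := by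
    rintro (b | b)
    · exact F'.ε_hom b
    · exact ⟨1, rfl⟩
  D_comp := by
    rintro (_ | i)
    · refine (Matrix.fromBlocks_multiply (F'.D 0) (φ.φ 0) 0 (Matrix.of fun _ b => -φ.ψ b)
        (F'.D 1) (φ.φ 1) 0 (-Ft.D 0)).trans ?_
      have h : (Matrix.of fun (_ : Unit) b => -φ.ψ b) * Ft.D 0 = 0 := by
        ext1 _ b
        simp [Matrix.mul_apply, φ.ψ_D b]
      rw [F'.D_comp 0, φ.φ_comm 0, Matrix.mul_neg, Matrix.mul_neg, h]
      simp
      rfl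
    · refine (Matrix.fromBlocks_multiply (F'.D (i + 1)) (φ.φ (i + 1)) 0 (-Ft.D i)
        (F'.D (i + 2)) (φ.φ (i + 2)) 0 (-Ft.D (i + 1))).trans ?_
      have h : -Ft.D i * -Ft.D (i + 1) = 0 := by
        rw [Matrix.neg_mul, Matrix.mul_neg, Ft.D_comp i, neg_zero, neg_zero]
      rw [F'.D_comp (i + 1), φ.φ_comm (i + 1), Matrix.mul_neg, h]
      simp
      rfl
  ε_comp := by
    rintro (b | b)
    · refine (Fintype.sum_sum_type _).trans ?_
      have h := F'.ε_comp b
      simpa [coneD, coneε] using h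
    · refine (Fintype.sum_sum_type _).trans ?_
      have h := φ.φ_aug b
      have h2 := φ.ψ_aug b
      simp [coneD, coneε, h, h2]

end ConeLift

/-- The zero complex, which resolves the zero ideal. -/
noncomputable def zeroComplex (k : Type*) [Field k] (σ : Type*) :
    AugFreeComplex k σ (polyGrading k σ) where
  B := fun _ => Empty
  fin := fun _ => inferInstance
  deg := fun _ => Empty.elim
  D := fun _ => 0
  ε := Empty.elim
  D_hom := fun _ a => a.elim
  ε_hom := fun a => a.elim
  D_comp := fun _ => by simp
  ε_comp := fun a => a.elim

/-- The list `L` is an ordering of the minimal monomial generating set of `I`. -/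
def IsGenOrdering (L : List (σ →₀ ℕ)) (I : Ideal (MvPolynomial σ k)) : Prop :=
  L.Nodup ∧ {μ | μ ∈ L} = minGens I

/-- `F` is an iterated mapping cone complex for the ideal whose minimal generators, in the chosen
order, are the members of the list. For `J = ⟨f_1, …, f_r⟩` it is the mapping cone of a lift
`F̃ → F' ⊕ S(-f_r)`, where `F'` is an iterated mapping cone for `J' = ⟨f_1, …, f_{r-1}⟩` with the
same order and `F̃` is an iterated mapping cone for `J̃ = J' ∩ ⟨f_r⟩` with some order of the minimal
generators of `J̃`. -/
inductive IsIteratedMappingCone :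
    List (σ →₀ ℕ) → AugFreeComplex k σ (polyGrading k σ) → Prop
  | zero : IsIteratedMappingCone [] (zeroComplex k σ)
  | cone (L L' : List (σ →₀ ℕ)) (f : σ →₀ ℕ)
      (F' Ft : AugFreeComplex k σ (polyGrading k σ)) (φ : ConeLift F' Ft f)
      (hF' : IsIteratedMappingCone L F')
      (hL' : IsGenOrdering L' (monomialSpan k {μ | μ ∈ L} ⊓ monomialSpan k {f}))
      (hFt : IsIteratedMappingCone L' Ft) :
      IsIteratedMappingCone (L ++ [f]) φ.cone

end Resolutions

/-! ### Homogeneous matrix entries and homogeneous parts. -/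

section HomogeneousParts

variable {k : Type*} [Field k] {σ : Type*}

/-! Write `a_i` for `x_{i1}^3 x_{i2}` and `e_i` for `x_{i1}^2 x_{(i+1)1} x_{(i+1)2}`, indices
cyclic. Since `e_i` divides `lcm(a_i, a_{i+1})`, neighbouring `a`'s are declared to be in conflict.
This is the only obstruction to a Taylor-like resolution: no generator outside a conflict-free set
`T` divides `lcm T` (`diamondExp_inl_not_le`, `diamondExp_inr_not_le`). The minimal resolution has
one basis element for each nonempty conflict-free `T`, of multidegree `lcm T`, in homological degree
`|T| - 1`.

It is built by mapping cones, with the `e`'s attached before the `a`'s. When `v` is attached, the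
intersection with `⟨v⟩` is generated by the `lcm(u, v)` with `u` earlier and not in conflict with
`v`, because for a conflicting `u` some earlier `e` divides `lcm(u, v)`. The intersection has the
same shape, so the induction `IsConeOrder.exists_iteratedMappingCone_of_prefix` runs over all lists
of lcms with a fixed conflict-free set `K`.

Only divisibilities between generators and lcms are used, and polarization preserves these together
with the degrees of lcms (`SamePolarityClass.exists_transfer`). Hence the construction works
directly for `J`. The invariants become extremal problems on conflict-free sets: `|T|` is at most `m
+ ⌊m/2⌋`, and `deg lcm T - |T|` is at most `2m`, with equality when `T` consists of all the `e`'s.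
One minimal resolution suffices for the Betti numbers by `bettiNonzero_iff`, and for the projective
dimension by `Resolves.projectiveDimension_eq`. -/

theorem MultiHom.eq_zero_or_monomial {p : MvPolynomial σ k} {a b : σ →₀ ℕ} (h : MultiHom p a b) :
    p = 0 ∨ ∃ r c, r + a = b ∧ p = monomial r c := by
  classical
  by_cases hp : p = 0
  · exact Or.inl hp
  obtain ⟨r, hr⟩ := Finset.nonempty_iff_ne_empty.2 (mt support_eq_empty.1 hp)
  refine Or.inr ⟨r, coeff r p, h r hr, ?_⟩
  ext s
  rw [coeff_monomial]
  split_ifs with hs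
  · rw [hs]
  · by_contra hne
    exact hs (add_right_cancel ((h r hr).trans (h s (mem_support_iff.2 hne)).symm))

theorem multiHom_monomial {r a b : σ →₀ ℕ} (c : k) (h : r + a = b) :
    MultiHom (monomial r c) a b := by
  intro ν hν
  rw [Finset.mem_singleton.1 (support_monomial_subset hν), h]

theorem MultiHom.add {p q : MvPolynomial σ k} {a b : σ →₀ ℕ} (hp : MultiHom p a b)
    (hq : MultiHom q a b) : MultiHom (p + q) a b := by
  classical
  intro ν hν
  rcases Finset.mem_union.1 (support_add hν) with h | h
  · exact hp ν h
  · exact hq ν h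

theorem MultiHom.sum {ι : Type*} (s : Finset ι) {p : ι → MvPolynomial σ k} {a b : σ →₀ ℕ}
    (h : ∀ i ∈ s, MultiHom (p i) a b) : MultiHom (∑ i ∈ s, p i) a b :=
  Finset.sum_induction p (fun q => MultiHom q a b) (fun _ _ => MultiHom.add)
    (ConeLift.multiHom_zero a b) h

theorem MultiHom.mul {p q : MvPolynomial σ k} {a b c : σ →₀ ℕ} (hp : MultiHom p a b)
    (hq : MultiHom q b c) : MultiHom (p * q) a c := by
  rcases hp.eq_zero_or_monomial with rfl | ⟨r, x, hr, rfl⟩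
  · simpa using ConeLift.multiHom_zero a c
  rcases hq.eq_zero_or_monomial with rfl | ⟨s, y, hs, rfl⟩
  · simpa using ConeLift.multiHom_zero a c
  rw [monomial_mul]
  exact multiHom_monomial _ (by rw [← hs, ← hr]; abel)

/-- The part of `p` that is homogeneous of multidegree `0` as a map `S(-b) → S(-a)`. -/
noncomputable def homPart (a b : σ →₀ ℕ) : MvPolynomial σ k →+ MvPolynomial σ k :=
  open Classical in
  -- Subtraction of exponents is truncated, so without this case distinction an unrelated
  -- coefficient would be picked when `a ≤ b` fails.
  if a ≤ b then
    (monomial (b - a) : k →ₗ[k] MvPolynomial σ k).toAddMonoidHom.comp (coeffAddMonoidHom (b - a))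
  else 0

theorem homPart_monomial_of_eq {r a b : σ →₀ ℕ} (c : k) (h : r + a = b) :
    homPart a b (monomial r c) = monomial r c := by
  classical
  subst h
  simp [homPart, coeff_monomial]

theorem homPart_monomial_of_ne {r a b : σ →₀ ℕ} (c : k) (h : r + a ≠ b) :
    homPart a b (monomial r c) = 0 := by
  classical
  by_cases hab : a ≤ b
  · have : r ≠ b - a := fun h' => h (by rw [h', tsub_add_cancel_of_le hab])
    simp [homPart, hab, coeff_monomial, this]
  · simp [homPart, hab]

theorem multiHom_homPart (a b : σ →₀ ℕ) (p : MvPolynomial σ k) : MultiHom (homPart a b p) a b := by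
  by_cases hab : a ≤ b
  · simp only [homPart, hab, if_true]
    exact multiHom_monomial _ (tsub_add_cancel_of_le hab)
  · simpa [homPart, hab] using ConeLift.multiHom_zero a b

theorem MultiHom.homPart_eq {p : MvPolynomial σ k} {a b : σ →₀ ℕ} (h : MultiHom p a b) :
    homPart a b p = p := by
  rcases h.eq_zero_or_monomial with rfl | ⟨r, c, hr, rfl⟩
  · simp
  · exact homPart_monomial_of_eq c hr

/-- Multiplication by a homogeneous entry shifts all degrees by the same amount. Homogeneous parts
therefore pass through the differentials. -/
theorem homPart_mul {d : MvPolynomial σ k} {a b μ : σ →₀ ℕ} (hd : MultiHom d a b)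
    (p : MvPolynomial σ k) : homPart a μ (d * p) = d * homPart b μ p := by
  rcases hd.eq_zero_or_monomial with rfl | ⟨r, x, hr, rfl⟩
  · simp
  induction p using MvPolynomial.induction_on' with
  | monomial s y =>
    rw [monomial_mul]
    by_cases h : s + b = μ
    · rw [homPart_monomial_of_eq y h, homPart_monomial_of_eq, monomial_mul]
      rw [← h, ← hr]; abel
    · rw [homPart_monomial_of_ne y h, homPart_monomial_of_ne, mul_zero]
      intro h'; apply h; rw [← h', ← hr]; abel
  | add p q hp hq => rw [mul_add, map_add, hp, hq, map_add, mul_add]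

theorem mem_span_X_of_coeff_zero {p : MvPolynomial σ k} (h : coeff 0 p = 0) :
    p ∈ Ideal.span (Set.range (X : σ → MvPolynomial σ k)) := by
  rw [← Set.image_univ, mem_ideal_span_X_image]
  intro ν hν
  by_contra! hc
  have : ν = 0 := by ext i; simpa using hc i
  subst this
  exact mem_support_iff.1 hν h

theorem coeff_zero_of_mem_span_X {p : MvPolynomial σ k}
    (h : p ∈ Ideal.span (Set.range (X : σ → MvPolynomial σ k))) : coeff 0 p = 0 := by
  rw [← Set.image_univ, mem_ideal_span_X_image] at h
  by_contra hc
  obtain ⟨i, _, hi⟩ := h 0 (mem_support_iff.2 hc)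
  exact hi rfl

/-- A nonzero constant term would force `0 + a = b`. All minimality statements about cones rest on
this. -/
theorem MultiHom.mem_span_X {p : MvPolynomial σ k} {a b : σ →₀ ℕ} (h : MultiHom p a b)
    (hab : a ≠ b) : p ∈ Ideal.span (Set.range (X : σ → MvPolynomial σ k)) := by
  apply mem_span_X_of_coeff_zero
  by_contra hc
  exact hab (by simpa using h 0 (mem_support_iff.2 hc))

/-- The module is the direct sum of the components `𝓜 μ`, as far as the projections to them are
concerned: there are additive maps picking the terms of multidegree `μ`. -/
def HasHomogeneousProjections {M : Type*} [AddCommGroup M] [Module (MvPolynomial σ k) M]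
    (𝓜 : (σ →₀ ℕ) → AddSubgroup M) : Prop :=
  ∃ π : (σ →₀ ℕ) → M →+ M, ∀ μ ν r c, ∀ x ∈ 𝓜 ν,
    (r + ν = μ → π μ (monomial r (c : k) • x) = monomial r c • x) ∧
    (r + ν ≠ μ → π μ (monomial r c • x) = 0)

theorem hasHomogeneousProjections_polyGrading :
    HasHomogeneousProjections (k := k) (polyGrading k σ) := by
  classical
  refine ⟨fun μ => homPart 0 μ, ?_⟩
  rintro μ ν r c _ ⟨y, rfl⟩
  constructor
  · intro h
    simp only [smul_eq_mul, monomial_mul]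
    exact homPart_monomial_of_eq _ (by simpa using h)
  · intro h
    simp only [smul_eq_mul, monomial_mul]
    exact homPart_monomial_of_ne _ (by simpa using h)

end HomogeneousParts

/-! ### Comparison of resolutions and uniqueness of the multidegrees. -/

theorem exists_dependent_seq {X : ℕ → Type*} {P : ∀ i, X i → Prop}
    {R : ∀ i, X i → X (i + 1) → Prop} (x₀ : X 0) (h₀ : P 0 x₀)
    (step : ∀ i x, P i x → ∃ y, P (i + 1) y ∧ R i x y) :
    ∃ s : ∀ i, X i, s 0 = x₀ ∧ (∀ i, P i (s i)) ∧ ∀ i, R i (s i) (s (i + 1)) := by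
  choose f hf hR using step
  let t : ∀ i, {x : X i // P i x} := fun i =>
    Nat.rec ⟨x₀, h₀⟩ (fun i x => ⟨f i x.1 x.2, hf i x.1 x.2⟩) i
  exact ⟨fun i => (t i).1, rfl, fun i => (t i).2, fun i => hR i (t i).1 (t i).2⟩

namespace AugFreeComplex

variable {k : Type*} [Field k] {σ : Type*} {M : Type*} [AddCommGroup M]
  [Module (MvPolynomial σ k) M] {𝓜 : (σ →₀ ℕ) → AddSubgroup M}

/-- Exactness in `Resolves` ignores degrees; taking homogeneous parts of an arbitrary preimage
repairs this. -/
theorem exists_homogeneous_preimage (F : AugFreeComplex k σ 𝓜) (i : ℕ) {μ : σ →₀ ℕ}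
    {v : F.B i → MvPolynomial σ k} (hv : ∀ a, MultiHom (v a) (F.deg i a) μ)
    {w : F.B (i + 1) → MvPolynomial σ k} (h : v = (F.D i).mulVec w) :
    ∃ w', (∀ b, MultiHom (w' b) (F.deg (i + 1) b) μ) ∧ v = (F.D i).mulVec w' := by
  refine ⟨fun b => homPart (F.deg (i + 1) b) μ (w b), fun b => multiHom_homPart _ _ _, ?_⟩
  ext1 a
  rw [← (hv a).homPart_eq, h]
  simp only [Matrix.mulVec, dotProduct, map_sum]
  exact Finset.sum_congr rfl fun b _ => homPart_mul (F.D_hom i a b) _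

theorem exists_homogeneous_combination (F : AugFreeComplex k σ 𝓜)
    (h𝓜 : HasHomogeneousProjections (k := k) 𝓜) {μ : σ →₀ ℕ} {x : M} (hx : x ∈ 𝓜 μ)
    {w : F.B 0 → MvPolynomial σ k} (h : ∑ a, w a • F.ε a = x) :
    ∃ w' : F.B 0 → MvPolynomial σ k, (∀ b, MultiHom (w' b) (F.deg 0 b) μ) ∧
      ∑ a, w' a • F.ε a = x := by
  obtain ⟨π, hπ⟩ := h𝓜
  refine ⟨fun b => homPart (F.deg 0 b) μ (w b), fun b => multiHom_homPart _ _ _, ?_⟩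
  have hx' : π μ x = x := by
    have := (hπ μ μ 0 1 x hx).1 (zero_add _)
    rwa [show (monomial 0 (1 : k) : MvPolynomial σ k) = 1 from rfl, one_smul] at this
  rw [← hx', ← h, map_sum]
  refine Finset.sum_congr rfl fun a _ => ?_
  beta_reduce
  induction w a using MvPolynomial.induction_on' with
  | monomial s y =>
    by_cases hs : s + F.deg 0 a = μ
    · rw [homPart_monomial_of_eq y hs, (hπ μ _ s y _ (F.ε_hom a)).1 hs]
    · rw [homPart_monomial_of_ne y hs, (hπ μ _ s y _ (F.ε_hom a)).2 hs, zero_smul]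
  | add p q hp hq => rw [map_add, add_smul, hp, hq, add_smul, map_add]

/-- The comparison theorem: a complex whose augmentation lands in `N` maps to any resolution of
`N`, by a chain map of multidegree `0`. -/
theorem exists_comparison {N : Submodule (MvPolynomial σ k) M}
    (h𝓜 : HasHomogeneousProjections (k := k) 𝓜) (F G : AugFreeComplex k σ 𝓜)
    (hF : ∀ b, F.ε b ∈ N) (hG : G.Resolves N) :
    ∃ φ : ∀ i, Matrix (G.B i) (F.B i) (MvPolynomial σ k),
      (∀ i a b, MultiHom (φ i a b) (G.deg i a) (F.deg i b)) ∧
      (∀ i, G.D i * φ (i + 1) = φ i * F.D i) ∧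
      ∀ b, ∑ a, φ 0 a b • G.ε a = F.ε b := by
  obtain ⟨hspan, hex0, hex⟩ := hG
  have h0 : ∀ b, ∃ w : G.B 0 → MvPolynomial σ k,
      (∀ a, MultiHom (w a) (G.deg 0 a) (F.deg 0 b)) ∧ ∑ a, w a • G.ε a = F.ε b := by
    intro b
    have hb := hF b
    rw [← hspan] at hb
    obtain ⟨w, hw⟩ := (Submodule.mem_span_range_iff_exists_fun _).1 hb
    exact G.exists_homogeneous_combination h𝓜 (F.ε_hom b) hw
  choose w₀ hw₀ hε using h0
  -- The invariant asks that the columns of `φ * F.D i` are boundaries. In this form it is the same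
  -- in degree `0`, where exactness refers to `ε`, and in higher degrees.
  let P : ∀ i, Matrix (G.B i) (F.B i) (MvPolynomial σ k) → Prop := fun i φ =>
    (∀ a b, MultiHom (φ a b) (G.deg i a) (F.deg i b)) ∧
    ∀ c, ∃ w, (fun a => (φ * F.D i) a c) = (G.D i).mulVec w
  have hP0 : P 0 (Matrix.of fun a b => w₀ b a) := by
    refine ⟨fun a b => hw₀ b a, fun c => hex0 _ ?_⟩
    simp only [Matrix.mul_apply, Matrix.of_apply, Finset.sum_smul]
    rw [Finset.sum_comm, ← F.ε_comp c]
    refine Finset.sum_congr rfl fun b _ => ?_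
    rw [← hε b, Finset.smul_sum]
    refine Finset.sum_congr rfl fun a _ => ?_
    rw [smul_smul, mul_comm]
  obtain ⟨φ, hφ0, hφP, hφ⟩ := exists_dependent_seq (P := P)
    (R := fun i φ ψ => G.D i * ψ = φ * F.D i) _ hP0 (by
      rintro i φ ⟨hhom, hker⟩
      have : ∀ c, ∃ w', (∀ b, MultiHom (w' b) (G.deg (i + 1) b) (F.deg (i + 1) c)) ∧
          (fun a => (φ * F.D i) a c) = (G.D i).mulVec w' := by
        intro c
        obtain ⟨w, hw⟩ := hker c
        refine G.exists_homogeneous_preimage i (fun a => ?_) hw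
        rw [Matrix.mul_apply]
        exact MultiHom.sum _ fun b _ => (hhom a b).mul (F.D_hom i b c)
      choose w' hw' hD using this
      have hcomm : G.D i * (Matrix.of fun a c => w' c a) = φ * F.D i := by
        ext1 a c
        exact (congrFun (hD c) a).symm
      refine ⟨Matrix.of fun a c => w' c a, ⟨fun a c => hw' c a, fun c => hex i _ ?_⟩, hcomm⟩
      have h2 : G.D i * ((Matrix.of fun a c => w' c a) * F.D (i + 1)) = 0 := by
        rw [← Matrix.mul_assoc, hcomm, Matrix.mul_assoc, F.D_comp, Matrix.mul_zero]
      ext1 a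
      exact congrFun (congrFun h2 a) c)
  refine ⟨φ, fun i => (hφP i).1, hφ, fun b => ?_⟩
  rw [hφ0]
  exact hε b

/-- A chain endomorphism of a resolution that lifts zero is null-homotopic, hence vanishes modulo
the variables if the resolution is minimal. -/
theorem mem_of_lift_zero {N : Submodule (MvPolynomial σ k) M} (F : AugFreeComplex k σ 𝓜)
    (hF : F.Resolves N) (hmin : F.IsMinimal)
    (χ : ∀ i, Matrix (F.B i) (F.B i) (MvPolynomial σ k))
    (hcomm : ∀ i, F.D i * χ (i + 1) = χ i * F.D i)
    (hε : ∀ b, ∑ a, χ 0 a b • F.ε a = 0) (i : ℕ) (a b : F.B i) :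
    χ i a b ∈ Ideal.span (Set.range (X : σ → MvPolynomial σ k)) := by
  obtain ⟨-, hex0, hex⟩ := hF
  have h0 : ∃ h : Matrix (F.B 1) (F.B 0) (MvPolynomial σ k), χ 0 = F.D 0 * h := by
    have : ∀ b, ∃ w, (fun a => χ 0 a b) = (F.D 0).mulVec w := fun b => hex0 _ (hε b)
    choose w hw using this
    refine ⟨Matrix.of fun a b => w b a, ?_⟩
    ext1 a b
    exact congrFun (hw b) a
  obtain ⟨h₀, hh₀⟩ := h0
  -- `R` is the homotopy identity; the invariant `P` is what makes `χ (i + 1) - h * F.D i` a cycle.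
  -- The homotopy need not be homogeneous.
  obtain ⟨h, hs0, -, hR⟩ := exists_dependent_seq
    (X := fun i => Matrix (F.B (i + 1)) (F.B i) (MvPolynomial σ k))
    (P := fun i h => F.D i * h * F.D i = χ i * F.D i)
    (R := fun i h h' => χ (i + 1) = F.D (i + 1) * h' + h * F.D i) h₀ (by rw [hh₀]) (by
      intro i h hP
      have : ∀ b, ∃ w, (fun a => (χ (i + 1) - h * F.D i) a b) = (F.D (i + 1)).mulVec w := by
        intro b
        apply hex
        have : F.D i * (χ (i + 1) - h * F.D i) = 0 := by
          rw [Matrix.mul_sub, hcomm, ← Matrix.mul_assoc, hP, sub_self]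
        ext1 a
        exact congrFun (congrFun this a) b
      choose w hw using this
      have key : χ (i + 1) - h * F.D i = F.D (i + 1) * (Matrix.of fun a b => w b a) := by
        ext1 a b
        exact congrFun (hw b) a
      refine ⟨Matrix.of fun a b => w b a, ?_, ?_⟩
      · rw [← key, Matrix.sub_mul, Matrix.mul_assoc, F.D_comp, Matrix.mul_zero, sub_zero]
      · rw [← key, sub_add_cancel])
  have hl : ∀ i {c} (g : Matrix (F.B (i + 1)) c (MvPolynomial σ k)) a b,
      (F.D i * g) a b ∈ Ideal.span (Set.range (X : σ → MvPolynomial σ k)) := fun i c g a b => by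
    rw [Matrix.mul_apply]
    exact Ideal.sum_mem _ fun j _ => Ideal.mul_mem_right _ _ (hmin i a j)
  cases i with
  | zero => rw [hh₀]; exact hl _ _ _ _
  | succ i =>
    rw [hR i, Matrix.add_apply]
    refine Ideal.add_mem _ (hl _ _ _ _) ?_
    rw [Matrix.mul_apply]
    exact Ideal.sum_mem _ fun j _ => Ideal.mul_mem_left _ _ (hmin i j b)

/-- The multidegrees of a minimal resolution occur in every resolution. -/
theorem exists_deg_eq {N : Submodule (MvPolynomial σ k) M}
    (h𝓜 : HasHomogeneousProjections (k := k) 𝓜) (F G : AugFreeComplex k σ 𝓜)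
    (hF : F.Resolves N) (hmin : F.IsMinimal) (hG : G.Resolves N) (i : ℕ) (b : F.B i) :
    ∃ c, G.deg i c = F.deg i b := by
  classical
  have hFε : ∀ b, F.ε b ∈ N := fun b => hF.1 ▸ Submodule.subset_span ⟨b, rfl⟩
  have hGε : ∀ b, G.ε b ∈ N := fun b => hG.1 ▸ Submodule.subset_span ⟨b, rfl⟩
  obtain ⟨α, hαh, hαc, hαε⟩ := exists_comparison h𝓜 F G hFε hG
  obtain ⟨β, hβh, hβc, hβε⟩ := exists_comparison h𝓜 G F hGε hF
  -- The composite `β α` and the identity lift the same map, so their difference vanishes modulo the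
  -- variables. If no multidegree of `G` matched that of `b`, the diagonal entry of `β α` at `b`
  -- would vanish there too, and so would `1`.
  have key := mem_of_lift_zero F hF hmin (fun i => β i * α i - 1) (by
      intro i
      rw [Matrix.mul_sub, Matrix.sub_mul, ← Matrix.mul_assoc, hβc, Matrix.mul_assoc, hαc,
        Matrix.mul_assoc, Matrix.mul_one, Matrix.one_mul]) (by
      intro b
      simp only [Matrix.sub_apply, sub_smul, Finset.sum_sub_distrib, Matrix.mul_apply,
        Finset.sum_smul]
      rw [Finset.sum_comm]
      have : ∑ x, (1 : Matrix (F.B 0) (F.B 0) (MvPolynomial σ k)) x b • F.ε x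
          = F.ε b := by simp [Matrix.one_apply]
      rw [sub_eq_zero]
      refine Eq.trans ?_ this.symm
      rw [← hαε b]
      refine Finset.sum_congr rfl fun a _ => ?_
      rw [← hβε a, Finset.smul_sum]
      refine Finset.sum_congr rfl fun c _ => ?_
      rw [smul_smul, mul_comm]) i b b
  by_contra! hne
  have h1 : (β i * α i) b b ∈ Ideal.span (Set.range (X : σ → MvPolynomial σ k)) := by
    rw [Matrix.mul_apply]
    exact Ideal.sum_mem _ fun c _ => Ideal.mul_mem_left _ _ ((hαh i c b).mem_span_X (hne c))
  have h2 := Ideal.sub_mem _ h1 key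
  simp only [Matrix.sub_apply, Matrix.one_apply_eq, sub_sub_cancel] at h2
  simpa using coeff_zero_of_mem_span_X h2

end AugFreeComplex

/-- The multidegrees of any minimal resolution are the nonzero Betti numbers. -/
theorem bettiNonzero_iff {k : Type*} [Field k] {σ : Type*} {M : Type*} [AddCommGroup M]
    [Module (MvPolynomial σ k) M] {𝓜 : (σ →₀ ℕ) → AddSubgroup M}
    {N : Submodule (MvPolynomial σ k) M} (h𝓜 : HasHomogeneousProjections (k := k) 𝓜)
    (F : AugFreeComplex k σ 𝓜) (hF : F.Resolves N) (hmin : F.IsMinimal) (i : ℕ) (μ : σ →₀ ℕ) :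
    BettiNonzero 𝓜 N i μ ↔ ∃ b, F.deg i b = μ := by
  constructor
  · rintro ⟨G, hG, hGmin, b, rfl⟩
    exact G.exists_deg_eq h𝓜 F hG hGmin hF i b
  · exact fun h => ⟨F, hF, hmin, h⟩

/-! ### Mapping cones: exactness, minimality, existence of lifts. -/

namespace ConeLift

variable {k : Type*} [Field k] {σ : Type*}
  {F' Ft : AugFreeComplex k σ (polyGrading k σ)} {f : σ →₀ ℕ}

/-- The mapping cone of a lift of `J' ∩ ⟨x^f⟩ → J' ⊕ ⟨x^f⟩` resolves `J' + ⟨x^f⟩`. -/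
theorem cone_resolves (φ : ConeLift F' Ft f) {J' : Ideal (MvPolynomial σ k)}
    (hF' : F'.Resolves J') (hFt : Ft.Resolves (J' ⊓ Ideal.span {monomial f (1 : k)})) :
    φ.cone.Resolves (J' ⊔ Ideal.span {monomial f (1 : k)}) := by
  obtain ⟨hspan', hex0', hex'⟩ := hF'
  obtain ⟨hspant, hex0t, hext⟩ := hFt
  have hf0 : (monomial f (1 : k)) ≠ 0 := by simp
  have hψ : ∀ t : Ft.B 0 → MvPolynomial σ k,
      (∑ b, t b * φ.ψ b) * monomial f 1 = ∑ b, t b • Ft.ε b := by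
    intro t
    rw [Finset.sum_mul]
    refine Finset.sum_congr rfl fun b _ => ?_
    rw [mul_assoc, φ.ψ_aug, smul_eq_mul]
  have hφ : ∀ t : Ft.B 0 → MvPolynomial σ k,
      ∑ a, (φ.φ 0).mulVec t a • F'.ε a = ∑ b, t b • Ft.ε b := by
    intro t
    simp only [Matrix.mulVec, dotProduct, Finset.sum_smul]
    rw [Finset.sum_comm]
    refine Finset.sum_congr rfl fun b _ => ?_
    rw [← φ.φ_aug b, Finset.smul_sum]
    refine Finset.sum_congr rfl fun a _ => ?_
    simp only [smul_eq_mul]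
    ring
  refine ⟨?_, ?_, ?_⟩
  · change Submodule.span _ (Set.range (Sum.elim F'.ε fun _ : Unit => monomial f (1 : k))) = _
    rw [Set.Sum.elim_range, Submodule.span_union, hspan', Set.range_const]
  · intro v hv
    change F'.B 0 ⊕ Unit → MvPolynomial σ k at v
    have hv' : ∑ a, v (Sum.inl a) • F'.ε a + v (Sum.inr ()) * monomial f 1 = 0 := by
      have := (Fintype.sum_sum_type (α₁ := F'.B 0) (α₂ := Unit) _).symm.trans hv
      simpa [cone, coneε] using this
    -- For a cycle the two components give the same element up to sign, so it lies in the
    -- intersection and comes from some `t` in `Ft`. Subtracting the image of `t` leaves a cycle of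
    -- `F'`.
    have hz : ∑ a, v (Sum.inl a) • F'.ε a ∈ J' ⊓ Ideal.span {monomial f (1 : k)} := by
      constructor
      · rw [← hspan']
        exact (Submodule.mem_span_range_iff_exists_fun _).2 ⟨_, rfl⟩
      · rw [eq_neg_of_add_eq_zero_left hv']
        exact Ideal.mem_span_singleton'.2 ⟨-v (Sum.inr ()), by ring⟩
    rw [← hspant] at hz
    obtain ⟨t, ht⟩ := (Submodule.mem_span_range_iff_exists_fun _).1 hz
    obtain ⟨w, hw⟩ := hex0' ((fun a => v (Sum.inl a)) - (φ.φ 0).mulVec t) (by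
      simp only [Pi.sub_apply, sub_smul, Finset.sum_sub_distrib]
      rw [hφ, ht, sub_self])
    refine ⟨(Sum.elim w t : F'.B 1 ⊕ Ft.B 0 → MvPolynomial σ k), ?_⟩
    refine Eq.trans ?_ (Matrix.fromBlocks_mulVec (F'.D 0) (φ.φ 0) 0
      (Matrix.of fun _ b => -φ.ψ b) (Sum.elim w t)).symm
    simp only [Sum.elim_comp_inl, Sum.elim_comp_inr, ← hw]
    ext1 (a | a)
    · simp
    · apply mul_right_cancel₀ hf0
      rw [eq_neg_of_add_eq_zero_right hv', ← ht, ← hψ]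
      simp [Matrix.mulVec, dotProduct, mul_comm]
  · have key : ∀ i (u : F'.B (i + 1) → MvPolynomial σ k) (t' : Ft.B (i + 1) → MvPolynomial σ k),
        (F'.D i).mulVec u + (φ.φ i).mulVec ((Ft.D i).mulVec t') = 0 →
        ∃ w, u = (F'.D (i + 1)).mulVec w + (φ.φ (i + 1)).mulVec (-t') := by
      intro i u t' h
      rw [Matrix.mulVec_mulVec, ← φ.φ_comm, ← Matrix.mulVec_mulVec, ← Matrix.mulVec_add] at h
      obtain ⟨w, hw⟩ := hex' i _ h
      exact ⟨w, by rw [← hw, Matrix.mulVec_neg, add_neg_cancel_right]⟩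
    have fin : ∀ i (v : F'.B (i + 1) ⊕ Ft.B i → MvPolynomial σ k)
        (t' : Ft.B (i + 1) → MvPolynomial σ k), (v ∘ Sum.inr = (Ft.D i).mulVec t') →
        (F'.D i).mulVec (v ∘ Sum.inl) + (φ.φ i).mulVec (v ∘ Sum.inr) = 0 →
        ∃ w, v = (Matrix.fromBlocks (F'.D (i + 1)) (φ.φ (i + 1)) 0 (-Ft.D i)).mulVec w := by
      intro i v t' ht h
      rw [ht] at h
      obtain ⟨w, hw⟩ := key i _ t' h
      refine ⟨Sum.elim w (-t'), ?_⟩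
      rw [Matrix.fromBlocks_mulVec]
      simp only [Sum.elim_comp_inl, Sum.elim_comp_inr, ← hw]
      rw [Matrix.zero_mulVec, zero_add, Matrix.neg_mulVec, Matrix.mulVec_neg, neg_neg, ← ht,
        Sum.elim_comp_inl_inr]
    rintro (_ | i) v hv
    · change F'.B 1 ⊕ Ft.B 0 → MvPolynomial σ k at v
      have hv' := (Matrix.fromBlocks_mulVec (F'.D 0) (φ.φ 0) 0
        (Matrix.of fun (_ : Unit) b => -φ.ψ b) v).symm.trans hv
      have h1 : (F'.D 0).mulVec (v ∘ Sum.inl) + (φ.φ 0).mulVec (v ∘ Sum.inr) = 0 :=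
        funext fun a => congrFun hv' (Sum.inl a)
      -- Since `ψ` times `x^f` is the augmentation of `Ft`, this row says that the `Ft` component is
      -- in the kernel of that augmentation.
      have h2 : ∑ b, v (Sum.inr b) * φ.ψ b = 0 := by
        have := (congrFun hv' (Sum.inr ())).trans (b := (0 : MvPolynomial σ k)) rfl
        simpa [Matrix.mulVec, dotProduct, mul_comm] using this
      obtain ⟨t', ht'⟩ := hex0t (v ∘ Sum.inr) (by
        have := hψ (v ∘ Sum.inr)
        simp only [Function.comp_apply, h2, zero_mul] at this
        exact this.symm)
      exact fin 0 v t' ht' h1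
    · change F'.B (i + 2) ⊕ Ft.B (i + 1) → MvPolynomial σ k at v
      have hv' := (Matrix.fromBlocks_mulVec (F'.D (i + 1)) (φ.φ (i + 1)) 0 (-Ft.D i) v).symm.trans
        hv
      have h1 : (F'.D (i + 1)).mulVec (v ∘ Sum.inl) + (φ.φ (i + 1)).mulVec (v ∘ Sum.inr) = 0 :=
        funext fun a => congrFun hv' (Sum.inl a)
      have h2 : (Ft.D i).mulVec (v ∘ Sum.inr) = 0 := by
        ext1 a
        have := (congrFun hv' (Sum.inr a)).trans (b := (0 : MvPolynomial σ k)) rfl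
        simpa [Matrix.neg_mulVec] using this
      obtain ⟨t', ht'⟩ := hext i _ h2
      exact fin (i + 1) v t' ht' h1

/-- The cone is minimal if the multidegrees of the two complexes are different in each homological
degree. -/
theorem cone_isMinimal (φ : ConeLift F' Ft f) (hF' : F'.IsMinimal) (hFt : Ft.IsMinimal)
    (h : ∀ i a b, F'.deg i a ≠ Ft.deg i b) (hf : ∀ b, f ≠ Ft.deg 0 b) : φ.cone.IsMinimal := by
  rintro (_ | i) (a | a) (b | b)
  · exact hF' 0 a b
  · exact (φ.φ_hom 0 a b).mem_span_X (h 0 a b)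
  · exact Ideal.zero_mem _
  · exact Ideal.neg_mem_iff _ |>.2 ((φ.ψ_hom b).mem_span_X (hf b))
  · exact hF' (i + 1) a b
  · exact (φ.φ_hom (i + 1) a b).mem_span_X (h (i + 1) a b)
  · exact Ideal.zero_mem _
  · exact Ideal.neg_mem_iff _ |>.2 (hFt i a b)

/-- Lifts of `J' ∩ ⟨x^f⟩ → J' ⊕ ⟨x^f⟩` exist. -/
theorem nonempty_of_resolves {J' : Ideal (MvPolynomial σ k)} (hF' : F'.Resolves J')
    (hFt : Ft.Resolves (J' ⊓ Ideal.span {monomial f (1 : k)})) : Nonempty (ConeLift F' Ft f) := by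
  have hmem : ∀ b, Ft.ε b ∈ J' ⊓ Ideal.span {monomial f (1 : k)} :=
    fun b => hFt.1 ▸ Submodule.subset_span ⟨b, rfl⟩
  obtain ⟨φ, hφ, hcomm, hε⟩ := AugFreeComplex.exists_comparison
    hasHomogeneousProjections_polyGrading Ft F' (fun b => (hmem b).1) hF'
  have hψ : ∀ b, ∃ p, MultiHom p f (Ft.deg 0 b) ∧ p * monomial f (1 : k) = Ft.ε b := by
    intro b
    obtain ⟨p, hp⟩ := Ideal.mem_span_singleton'.1 (hmem b).2
    refine ⟨homPart f (Ft.deg 0 b) p, multiHom_homPart _ _ _, ?_⟩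
    have hε : MultiHom (Ft.ε b) 0 (Ft.deg 0 b) := by
      obtain ⟨c, hc⟩ := Ft.ε_hom b
      rw [← hc]
      exact multiHom_monomial _ (add_zero _)
    rw [← hε.homPart_eq, ← hp, mul_comm p, homPart_mul (multiHom_monomial 1 (add_zero f)),
      mul_comm]
  choose ψ hψh hψe using hψ
  exact ⟨⟨φ, ψ, hφ, hψh, hcomm, hε, hψe⟩⟩

theorem exists_cone_deg_zero (φ : ConeLift F' Ft f) (μ : σ →₀ ℕ) :
    (∃ b, φ.cone.deg 0 b = μ) ↔ (∃ b, F'.deg 0 b = μ) ∨ f = μ := by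
  constructor
  · rintro ⟨b | b, h⟩
    · exact Or.inl ⟨b, h⟩
    · exact Or.inr h
  · rintro (⟨b, h⟩ | h)
    · exact ⟨Sum.inl b, h⟩
    · exact ⟨Sum.inr (), h⟩

theorem exists_cone_deg_succ (φ : ConeLift F' Ft f) (i : ℕ) (μ : σ →₀ ℕ) :
    (∃ b, φ.cone.deg (i + 1) b = μ) ↔ (∃ b, F'.deg (i + 1) b = μ) ∨ ∃ b, Ft.deg i b = μ := by
  constructor
  · rintro ⟨b | b, h⟩
    · exact Or.inl ⟨b, h⟩
    · exact Or.inr ⟨b, h⟩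
  · rintro (⟨b, h⟩ | ⟨b, h⟩)
    · exact ⟨Sum.inl b, h⟩
    · exact ⟨Sum.inr b, h⟩

end ConeLift

/-! ### Monomial ideals and their minimal generators. -/

section MonomialIdeals

variable {k : Type*} [Field k] {σ : Type*}

theorem mem_monomialSpan {A : Set (σ →₀ ℕ)} {p : MvPolynomial σ k} :
    p ∈ monomialSpan k A ↔ ∀ ν ∈ p.support, ∃ a ∈ A, a ≤ ν :=
  mem_ideal_span_monomial_image

theorem monomial_mem_monomialSpan {A : Set (σ →₀ ℕ)} {ν : σ →₀ ℕ} :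
    monomial ν (1 : k) ∈ monomialSpan k A ↔ ∃ a ∈ A, a ≤ ν := by
  classical
  rw [mem_monomialSpan]
  simp [support_monomial]

theorem monomialSpan_eq_of_forall_le {A B : Set (σ →₀ ℕ)} (hAB : ∀ a ∈ A, ∃ b ∈ B, b ≤ a)
    (hBA : ∀ b ∈ B, ∃ a ∈ A, a ≤ b) : monomialSpan k A = monomialSpan k B := by
  ext p
  rw [mem_monomialSpan, mem_monomialSpan]
  refine forall₂_congr fun ν _ => ⟨?_, ?_⟩
  · rintro ⟨a, ha, hν⟩
    obtain ⟨b, hb, hab⟩ := hAB a ha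
    exact ⟨b, hb, hab.trans hν⟩
  · rintro ⟨b, hb, hν⟩
    obtain ⟨a, ha, hab⟩ := hBA b hb
    exact ⟨a, ha, hab.trans hν⟩

theorem monomialSpan_inf (A B : Set (σ →₀ ℕ)) :
    monomialSpan k A ⊓ monomialSpan k B = monomialSpan k (Set.image2 (· ⊔ ·) A B) := by
  ext p
  rw [Ideal.mem_inf, mem_monomialSpan, mem_monomialSpan, mem_monomialSpan]
  constructor
  · rintro ⟨hA, hB⟩ ν hν
    obtain ⟨a, ha, haν⟩ := hA ν hν
    obtain ⟨b, hb, hbν⟩ := hB ν hν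
    exact ⟨_, ⟨a, ha, b, hb, rfl⟩, sup_le haν hbν⟩
  · intro h
    constructor <;> intro ν hν <;> obtain ⟨_, ⟨a, ha, b, hb, rfl⟩, hle⟩ := h ν hν
    · exact ⟨a, ha, le_sup_left.trans hle⟩
    · exact ⟨b, hb, le_sup_right.trans hle⟩

theorem minGens_monomialSpan {A : Set (σ →₀ ℕ)} (hA : IsAntichain (· ≤ ·) A) :
    minGens (monomialSpan k A) = A := by
  ext μ
  simp only [minGens, Set.mem_ofPred_eq, monomial_mem_monomialSpan]
  constructor
  · rintro ⟨⟨a, ha, hle⟩, hmin⟩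
    rwa [le_antisymm (hmin ⟨a, ha, le_rfl⟩ hle) hle]
  · refine fun hμ => ⟨⟨μ, hμ, le_rfl⟩, ?_⟩
    rintro ν ⟨a, ha, hle⟩ hνμ
    rwa [← hA.eq ha hμ (hle.trans hνμ)]

theorem monomialSpan_minGens {J : Ideal (MvPolynomial σ k)} (hJ : IsMonomialIdeal J) :
    monomialSpan k (minGens J) = J := by
  obtain ⟨A, rfl⟩ := hJ
  apply monomialSpan_eq_of_forall_le
  · rintro a ⟨ha, -⟩
    exact monomial_mem_monomialSpan.1 ha
  · intro b hb
    have hb' : monomial b (1 : k) ∈ monomialSpan k A := monomial_mem_monomialSpan.2 ⟨b, hb, le_rfl⟩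
    obtain ⟨a, hle, ha⟩ := exists_minimal_le_of_wellFoundedLT
      (fun ν : σ →₀ ℕ => monomial ν (1 : k) ∈ monomialSpan k A) b hb'
    exact ⟨a, ha, hle⟩

theorem isAntichain_minGens (J : Ideal (MvPolynomial σ k)) : IsAntichain (· ≤ ·) (minGens J) :=
  setOfPred_minimal_antichain _

end MonomialIdeals

/-! ### Iterated mapping cones from a conflict relation. -/

section ConflictSystems

variable {k : Type*} [Field k] {σ V : Type*}

/-- No two members of `K` are in conflict. -/
def ConflictFree (c : V → V → Prop) (K : Finset V) : Prop :=
  ∀ x ∈ K, ∀ y ∈ K, ¬c x y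

theorem ConflictFree.mono {c : V → V → Prop} {K K' : Finset V} (h : ConflictFree c K')
    (hK : K ⊆ K') : ConflictFree c K :=
  fun x hx y hy => h x (hK hx) y (hK hy)

variable [DecidableEq V]

open Classical in
/-- The least common multiples of `K.sup f` with those `f u`, for `u` in the list, that are not in
conflict with `K`. -/
noncomputable def lcmList (f : V → σ →₀ ℕ) (c : V → V → Prop) (l : List V) (K : Finset V) :
    List (σ →₀ ℕ) :=
  (l.filter fun u => ConflictFree c (insert u K)).map fun u => K.sup f ⊔ f u

theorem mem_lcmList {f : V → σ →₀ ℕ} {c : V → V → Prop} {l : List V} {K : Finset V}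
    {μ : σ →₀ ℕ} :
    μ ∈ lcmList f c l K ↔ ∃ u ∈ l, ConflictFree c (insert u K) ∧ K.sup f ⊔ f u = μ := by
  simp [lcmList, and_assoc]

/-- The conditions on an ordered family of monomials `f v` with a conflict relation `c` under which
iterated mapping cones are minimal and have the conflict-free sets as basis. -/
structure IsConeOrder (f : V → σ →₀ ℕ) (c : V → V → Prop) (l : List V) : Prop where
  nodup : l.Nodup
  symm : ∀ x y, c x y → c y x
  irrefl : ∀ x, ¬c x x
  -- This separates the multidegrees of `F'` from those of `Ft`, which are divisible by `f v`.
  not_le_of_prefix : ∀ pre v, pre ++ [v] <+: l → ∀ K : Finset V, ConflictFree c (insert v K) →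
    (∀ x ∈ K, x ∉ pre ++ [v]) → ¬f v ≤ K.sup f ⊔ pre.toFinset.sup f
  -- This makes the lcms in `lcmList` incomparable, and keeps the generators of `Ft` different from
  -- the new generator.
  not_le : ∀ u v, ∀ K : Finset V, u ≠ v → u ∉ K → ConflictFree c (insert u K) →
    ConflictFree c (insert v K) → ¬f u ≤ K.sup f ⊔ f v
  -- This makes conflicting pairs redundant in the intersection with the new generator.
  exists_le_of_conflict : ∀ pre v, pre ++ [v] <+: l → ∀ u ∈ pre, c u v →
    ∃ w ∈ pre, (∀ x, ¬c w x) ∧ f w ≤ f u ⊔ f v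

variable {f : V → σ →₀ ℕ} {c : V → V → Prop} {l : List V}

theorem IsConeOrder.isGenOrdering_lcmList (h : IsConeOrder f c l) {pre : List V}
    (hpre : pre <+: l) {K : Finset V} (hK : ∀ x ∈ K, x ∉ pre) :
    IsGenOrdering (lcmList f c pre K) (monomialSpan k {μ | μ ∈ lcmList f c pre K}) := by
  have key : ∀ u ∈ pre, ∀ v ∈ pre, ConflictFree c (insert u K) → ConflictFree c (insert v K) →
      K.sup f ⊔ f u ≤ K.sup f ⊔ f v → u = v := by
    intro u hu v hv hcu hcv hle
    by_contra hne
    exact h.not_le u v K hne (fun huK => hK u huK hu) hcu hcv (le_sup_right.trans hle)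
  constructor
  · refine List.Nodup.map_on ?_ ((h.nodup.sublist hpre.sublist).filter _)
    intro u hu v hv huv
    simp only [List.mem_filter, decide_eq_true_eq] at hu hv
    exact key u hu.1 v hv.1 hu.2 hv.2 huv.le
  · refine (minGens_monomialSpan ?_).symm
    intro μ hμ ν hν hne hle
    obtain ⟨u, hu, hcu, rfl⟩ := mem_lcmList.1 hμ
    obtain ⟨v, hv, hcv, rfl⟩ := mem_lcmList.1 hν
    exact hne (by rw [key u hu v hv hcu hcv hle])

/-- The intersection is generated by the lcms of `K`, `v` and an earlier `u`. If `u` is in conflict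
with `v`, the conflict-free `w` dividing `lcm(u, v)` gives a generator dividing that of `u`; this is
how the recursion closes up. -/
theorem IsConeOrder.monomialSpan_lcmList_inf (h : IsConeOrder f c l) {pre : List V} {v : V}
    (hpre : pre ++ [v] <+: l) {K : Finset V} (hv : ConflictFree c (insert v K)) :
    monomialSpan k {μ | μ ∈ lcmList f c pre K} ⊓ monomialSpan k {K.sup f ⊔ f v} =
      monomialSpan k {μ | μ ∈ lcmList f c pre (insert v K)} := by
  rw [monomialSpan_inf]
  apply monomialSpan_eq_of_forall_le
  · rintro _ ⟨_, hμ, _, rfl, rfl⟩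
    obtain ⟨u, hu, hcu, rfl⟩ := mem_lcmList.1 hμ
    by_cases huv : c u v
    · obtain ⟨w, hw, hfree, hle⟩ := h.exists_le_of_conflict pre v hpre u hu huv
      refine ⟨_, mem_lcmList.2 ⟨w, hw, ?_, rfl⟩, ?_⟩
      · intro x hx y hy hxy
        rcases Finset.mem_insert.1 hx with rfl | hx
        · exact hfree y hxy
        rcases Finset.mem_insert.1 hy with rfl | hy
        · exact hfree x (h.symm _ _ hxy)
        exact hv x hx y hy hxy
      · rw [Finset.sup_insert]
        refine sup_le (sup_le ?_ ?_) (hle.trans (sup_le ?_ ?_))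
        · exact le_sup_right.trans le_sup_right
        · exact le_sup_left.trans le_sup_left
        · exact le_sup_right.trans le_sup_left
        · exact le_sup_right.trans le_sup_right
    · refine ⟨_, mem_lcmList.2 ⟨u, hu, ?_, rfl⟩, ?_⟩
      · intro x hx y hy hxy
        rcases Finset.mem_insert.1 hx with hxu | hx'
        · rcases Finset.mem_insert.1 hy with hyu | hy'
          · exact h.irrefl u (by rwa [hxu, hyu] at hxy)
          rcases Finset.mem_insert.1 hy' with hyv | hyK
          · exact huv (by rwa [hxu, hyv] at hxy)
          exact hcu x (by simp [hxu]) y (by simp [hyK]) hxy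
        · rcases Finset.mem_insert.1 hy with hyu | hy'
          · rcases Finset.mem_insert.1 hx' with hxv | hxK
            · exact huv (h.symm _ _ (by rwa [hxv, hyu] at hxy))
            exact hcu x (by simp [hxK]) y (by simp [hyu]) hxy
          exact hv x hx' y hy' hxy
      · rw [Finset.sup_insert]
        refine sup_le (sup_le ?_ ?_) ?_
        · exact le_sup_right.trans le_sup_right
        · exact le_sup_left.trans le_sup_left
        · exact le_sup_right.trans le_sup_left
  · intro μ hμ
    obtain ⟨u, hu, hcu, rfl⟩ := mem_lcmList.1 hμ
    refine ⟨_, ⟨_, mem_lcmList.2 ⟨u, hu, hcu.mono ?_, rfl⟩, _, rfl, rfl⟩, ?_⟩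
    · exact Finset.insert_subset_insert _ (Finset.subset_insert _ _)
    · rw [Finset.sup_insert]
      refine sup_le (sup_le ?_ ?_) (sup_le ?_ ?_)
      · exact le_sup_right.trans le_sup_left
      · exact le_sup_right
      · exact le_sup_right.trans le_sup_left
      · exact le_sup_left.trans le_sup_left

theorem zeroComplex_resolves : (zeroComplex k σ).Resolves (⊥ : Ideal (MvPolynomial σ k)) := by
  refine ⟨?_, fun v _ => ⟨fun b => b.elim, ?_⟩, fun i v _ => ⟨fun b => b.elim, ?_⟩⟩
  · have : Set.range (zeroComplex k σ).ε = ∅ :=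
      Set.range_eq_empty_iff.2 (inferInstanceAs (IsEmpty Empty))
    rw [this, Submodule.span_empty]
  · ext1 a; exact Empty.elim a
  · ext1 a; exact Empty.elim a

/-- Splitting by whether `v ∈ T` mirrors the two summands `F'` and `Ft` of the cone. -/
theorem exists_subset_insert_iff {A : Finset V} {v : V} {Q : Finset V → Prop} :
    (∃ T, T ⊆ insert v A ∧ Q T) ↔ (∃ T, T ⊆ A ∧ Q T) ∨ ∃ T, T ⊆ A ∧ Q (insert v T) := by
  constructor
  · rintro ⟨T, hT, hQ⟩
    by_cases hv : v ∈ T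
    · exact Or.inr ⟨T.erase v, Finset.subset_insert_iff.1 hT, by rwa [Finset.insert_erase hv]⟩
    · exact Or.inl ⟨T, (Finset.subset_insert_iff_of_notMem hv).1 hT, hQ⟩
  · rintro (⟨T, hT, hQ⟩ | ⟨T, hT, hQ⟩)
    · exact ⟨T, hT.trans (Finset.subset_insert _ _), hQ⟩
    · exact ⟨_, Finset.insert_subset_insert _ hT, hQ⟩

/-- The iterated mapping cones for the lists `lcmList f c pre K` are minimal, with basis in
homological degree `i` the sets `T` of `i + 1` elements of `pre` such that `K ∪ T` is
conflict-free. -/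
theorem IsConeOrder.exists_iteratedMappingCone_of_prefix (h : IsConeOrder f c l) (pre : List V) :
    pre <+: l → ∀ K : Finset V, ConflictFree c K → (∀ x ∈ K, x ∉ pre) →
    ∃ F : AugFreeComplex k σ (polyGrading k σ), IsIteratedMappingCone (lcmList f c pre K) F ∧
      F.Resolves (monomialSpan k {μ | μ ∈ lcmList f c pre K}) ∧ F.IsMinimal ∧
      ∀ i μ, (∃ b, F.deg i b = μ) ↔
        ∃ T, T ⊆ pre.toFinset ∧ ConflictFree c (K ∪ T) ∧ T.card = i + 1 ∧ (K ∪ T).sup f = μ := by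
  induction pre using List.reverseRecOn with
  | nil =>
    intro _ K hK _
    refine ⟨zeroComplex k σ, IsIteratedMappingCone.zero, ?_, fun i a => a.elim, fun i μ => ?_⟩
    · have : monomialSpan k {μ | μ ∈ lcmList f c [] K} = ⊥ := by
        simp [lcmList, monomialSpan]
      rw [this]
      exact zeroComplex_resolves
    · constructor
      · rintro ⟨b, -⟩
        exact b.elim
      · rintro ⟨T, hT, -, hcard, -⟩
        rw [List.toFinset_nil, Finset.subset_empty] at hT
        simp [hT] at hcard
  | append_singleton pre v ih =>
    intro hpre K hK hdisj
    have hpre' : pre <+: l := (List.prefix_append pre [v]).trans hpre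
    have hvpre : v ∉ pre := by
      have := h.nodup.sublist hpre.sublist
      rw [List.nodup_append] at this
      exact fun hv => this.2.2 v hv v (by simp) rfl
    have hdisj' : ∀ x ∈ K, x ∉ pre := fun x hx hxp => hdisj x hx (by simp [hxp])
    have htf : (pre ++ [v]).toFinset = insert v pre.toFinset := by
      ext x; simp
    obtain ⟨F', hF'c, hF'r, hF'm, hF'd⟩ := ih hpre' K hK hdisj'
    -- If `v` is in conflict with `K`, the list does not change and no cone is attached. Otherwise
    -- `Ft` is the complex for the same prefix with `K` enlarged by `v`.
    by_cases hv : ConflictFree c (insert v K)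
    · obtain ⟨Ft, hFtc, hFtr, hFtm, hFtd⟩ := ih hpre' (insert v K) hv (by
        intro x hx
        rcases Finset.mem_insert.1 hx with rfl | hx
        exacts [hvpre, hdisj' x hx])
      have hL : lcmList f c (pre ++ [v]) K = lcmList f c pre K ++ [K.sup f ⊔ f v] := by
        simp [lcmList, hv]
      have hinf := h.monomialSpan_lcmList_inf (k := k) hpre hv
      have hgen := h.isGenOrdering_lcmList (k := k) hpre' (K := insert v K) (by
        intro x hx
        rcases Finset.mem_insert.1 hx with rfl | hx
        exacts [hvpre, hdisj' x hx])
      have hsing : monomialSpan k {K.sup f ⊔ f v} =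
          Ideal.span {monomial (K.sup f ⊔ f v) (1 : k)} := by
        rw [monomialSpan, Set.image_singleton]
      rw [← hinf] at hFtr hgen
      rw [hsing] at hFtr
      obtain ⟨φ⟩ := ConeLift.nonempty_of_resolves hF'r hFtr
      refine ⟨φ.cone, ?_, ?_, ?_, ?_⟩
      · rw [hL]
        exact IsIteratedMappingCone.cone _ _ _ F' Ft φ hF'c hgen hFtc
      · have : monomialSpan k {μ | μ ∈ lcmList f c (pre ++ [v]) K} =
            monomialSpan k {μ | μ ∈ lcmList f c pre K} ⊔
              Ideal.span {monomial (K.sup f ⊔ f v) (1 : k)} := by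
          rw [← hsing, hL]
          simp only [monomialSpan]
          rw [← Ideal.span_union, ← Set.image_union]
          congr 2
          ext μ
          simp [or_comm]
        rw [this]
        exact φ.cone_resolves hF'r hFtr
      · refine φ.cone_isMinimal hF'm hFtm ?_ ?_
        -- Multidegrees of `Ft` are divisible by `f v`, whereas those of `F'` divide the lcm of `K`
        -- and `pre`.
        · intro i a b hab
          obtain ⟨T, hT, -, -, hTs⟩ := (hF'd i _).1 ⟨a, rfl⟩
          obtain ⟨T', -, -, -, hTs'⟩ := (hFtd i _).1 ⟨b, rfl⟩
          apply h.not_le_of_prefix pre v hpre K hv hdisj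
          calc f v ≤ (insert v K ∪ T').sup f :=
                Finset.le_sup (Finset.mem_union_left _ (Finset.mem_insert_self _ _))
            _ = (K ∪ T).sup f := by rw [hTs', ← hab, hTs]
            _ ≤ _ := by
              rw [Finset.sup_union]
              exact sup_le_sup_left (Finset.sup_mono hT) _
        · intro b hb
          obtain ⟨T, hT, hc, hcard, hTs⟩ := (hFtd 0 _).1 ⟨b, rfl⟩
          obtain ⟨u, rfl⟩ := Finset.card_eq_one.1 hcard
          have hu : u ∈ pre := by simpa using hT
          refine h.not_le u v K ?_ (fun huK => hdisj' u huK hu) (hc.mono ?_) hv ?_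
          · rintro rfl; exact hvpre hu
          · intro x hx
            rcases Finset.mem_insert.1 hx with rfl | hx <;> simp_all
          · rw [hb, ← hTs]
            exact Finset.le_sup (by simp)
      · rintro (_ | i) μ
        · rw [φ.exists_cone_deg_zero, htf, exists_subset_insert_iff, hF'd]
          refine or_congr_right ⟨?_, ?_⟩
          · rintro rfl
            refine ⟨∅, Finset.empty_subset _, ?_, ?_, ?_⟩
            · rwa [insert_empty_eq, Finset.union_comm, ← Finset.insert_eq]
            · simp
            · rw [insert_empty_eq, Finset.sup_union, Finset.sup_singleton]
          · rintro ⟨T, hT, -, hcard, rfl⟩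
            rw [Finset.card_insert_of_notMem (fun hv => hvpre (by simpa using hT hv))] at hcard
            have : T = ∅ := by simpa using hcard
            subst this
            rw [insert_empty_eq, Finset.sup_union, Finset.sup_singleton]
        · rw [φ.exists_cone_deg_succ, htf, exists_subset_insert_iff, hF'd, hFtd]
          refine or_congr_right (exists_congr fun T => and_congr_right fun hT => ?_)
          rw [Finset.card_insert_of_notMem (fun hv => hvpre (by simpa using hT hv)),
            Finset.insert_union, Finset.union_insert, Nat.add_right_cancel_iff]
    · have hL : lcmList f c (pre ++ [v]) K = lcmList f c pre K := by
        simp [lcmList, hv]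
      refine ⟨F', ?_, ?_, hF'm, fun i μ => ?_⟩
      · rwa [hL]
      · rwa [hL]
      · rw [htf, exists_subset_insert_iff, hF'd]
        refine ⟨Or.inl, ?_⟩
        rintro (h' | ⟨T, hT, hc, -⟩)
        · exact h'
        · refine absurd (hc.mono ?_) hv
          rw [Finset.union_insert]
          exact Finset.insert_subset_insert _ Finset.subset_union_left

theorem IsConeOrder.exists_iteratedMappingCone (h : IsConeOrder f c l) :
    ∃ F : AugFreeComplex k σ (polyGrading k σ), IsIteratedMappingCone (l.map f) F ∧
      IsGenOrdering (l.map f) (monomialSpan k {μ | μ ∈ l.map f}) ∧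
      F.Resolves (monomialSpan k {μ | μ ∈ l.map f}) ∧ F.IsMinimal ∧
      ∀ i μ, (∃ b, F.deg i b = μ) ↔
        ∃ T, T ⊆ l.toFinset ∧ ConflictFree c T ∧ T.card = i + 1 ∧ T.sup f = μ := by
  have hl : lcmList f c l ∅ = l.map f := by
    have : ∀ v, ConflictFree c {v} := by
      intro v x hx y hy
      rw [Finset.mem_singleton.1 hx, Finset.mem_singleton.1 hy]
      exact h.irrefl v
    simp [lcmList, this]
  obtain ⟨F, h1, h2, h3, h4⟩ := h.exists_iteratedMappingCone_of_prefix (k := k) l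
    (List.prefix_refl l) ∅ (by intro x hx; simp at hx) (by simp)
  have h5 := h.isGenOrdering_lcmList (k := k) (List.prefix_refl l) (K := ∅) (by simp)
  rw [hl] at h1 h2 h5
  refine ⟨F, h1, h5, h2, h3, fun i μ => ?_⟩
  simpa using h4 i μ

end ConflictSystems

/-! ### Polarization preserves lcms, divisibility and degree. -/

section PolarizationTransfer

variable {k : Type*} [Field k] {σ : Type*} {τ : Type*}

theorem Finsupp.finset_sup_apply {V : Type*} (f : V → σ →₀ ℕ) (K : Finset V) (i : σ) :
    (K.sup f) i = K.sup fun v => f v i :=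
  Finset.apply_sup_eq_sup_comp (fun g : σ →₀ ℕ => g i) (fun _ _ => rfl) rfl

/-- The supremum in `ℕ` is an upper bound only for a bounded set; Dickson's lemma supplies
finiteness of the antichain of generators. -/
theorem le_maxExp [Finite σ] {I : Ideal (MvPolynomial σ k)} {μ : σ →₀ ℕ} (hμ : μ ∈ minGens I)
    (i : σ) : μ i ≤ maxExp I i := by
  have hfin : (minGens I).Finite :=
    (isAntichain_minGens I).finite_of_wellQuasiOrdered wellQuasiOrdered_le
  exact le_csSup (hfin.image _).bddAbove ⟨μ, hμ, rfl⟩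

variable [Finite σ] [Finite τ]

theorem polExp_apply (I : Ideal (MvPolynomial σ k)) (μ : σ →₀ ℕ) (p : PolVar I) :
    polExp I μ p = if (p.2 : ℕ) < μ p.1 then 1 else 0 := rfl

theorem polExp_mono (I : Ideal (MvPolynomial σ k)) {μ ν : σ →₀ ℕ} (h : μ ≤ ν) :
    polExp I μ ≤ polExp I ν := by
  intro p
  rw [polExp_apply, polExp_apply]
  have := h p.1
  split_ifs <;> omega

theorem polExp_le_polExp_iff {I : Ideal (MvPolynomial σ k)} {μ ν : σ →₀ ℕ}
    (hμ : ∀ i, μ i ≤ maxExp I i) : polExp I μ ≤ polExp I ν ↔ μ ≤ ν := by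
  refine ⟨fun h i => ?_, polExp_mono I⟩
  by_contra! hlt
  -- Counting copies from `0`, the copy with index `ν i` is the first one missing from `polExp I ν`.
  have := h ⟨i, ⟨ν i, hlt.trans_le (hμ i)⟩⟩
  rw [polExp_apply, polExp_apply] at this
  simp [hlt] at this

theorem polExp_finset_sup {V : Type*} (I : Ideal (MvPolynomial σ k)) (f : V → σ →₀ ℕ)
    (K : Finset V) : polExp I (K.sup f) = K.sup fun v => polExp I (f v) := by
  refine Finset.apply_sup_eq_sup_comp (polExp I) (fun μ ν => ?_) ?_
  · ext p
    simp only [polExp_apply, Finsupp.sup_apply, lt_sup_iff]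
    split_ifs <;> simp_all
  · change polExp I 0 = 0
    ext p
    simp [polExp_apply]

theorem degree_polExp {I : Ideal (MvPolynomial σ k)} {μ : σ →₀ ℕ}
    (hμ : ∀ i, μ i ≤ maxExp I i) : (polExp I μ).degree = μ.degree := by
  have := Fintype.ofFinite σ
  rw [Finsupp.degree_eq_sum, Finsupp.degree_eq_sum, Fintype.sum_sigma]
  refine Finset.sum_congr rfl fun i _ => ?_
  simp only [polExp_apply]
  rw [← Finset.card_filter, Fin.card_filter_val_lt, min_eq_right (hμ i)]

theorem minGens_polarization (I : Ideal (MvPolynomial σ k)) :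
    minGens (polarization I) = polExp I '' minGens I := by
  refine minGens_monomialSpan ?_
  rintro _ ⟨μ, hμ, rfl⟩ _ ⟨ν, hν, rfl⟩ hne hle
  rw [polExp_le_polExp_iff (le_maxExp hμ)] at hle
  exact hne (by rw [(isAntichain_minGens I).eq hμ hν hle])

theorem Finsupp.mapDomain_equiv_le_iff {α β : Type*} (e : α ≃ β) {μ ν : α →₀ ℕ} :
    Finsupp.mapDomain e μ ≤ Finsupp.mapDomain e ν ↔ μ ≤ ν := by
  constructor
  · intro h a
    simpa [Finsupp.mapDomain_equiv_apply] using h (e a)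
  · intro h b
    simpa [Finsupp.mapDomain_equiv_apply] using h (e.symm b)

theorem Finsupp.mapDomain_equiv_finset_sup {α β V : Type*} (e : α ≃ β) (f : V → α →₀ ℕ)
    (K : Finset V) :
    Finsupp.mapDomain e (K.sup f) = K.sup fun v => Finsupp.mapDomain e (f v) := by
  refine Finset.apply_sup_eq_sup_comp (Finsupp.mapDomain e) (fun μ ν => ?_) ?_
  · ext b
    simp [Finsupp.mapDomain_equiv_apply]
  · exact Finsupp.mapDomain_zero

/-- Ideals in the same polarity class have the same lcm lattice, with the same total degrees. -/
theorem SamePolarityClass.exists_transfer {I : Ideal (MvPolynomial σ k)}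
    {J : Ideal (MvPolynomial τ k)} (h : SamePolarityClass I J) {V : Type*} (f : V → σ →₀ ℕ)
    (hf : Set.range f = minGens I) :
    ∃ g : V → τ →₀ ℕ, Set.range g = minGens J ∧
      (∀ v K, g v ≤ Finset.sup K g ↔ f v ≤ K.sup f) ∧
      ∀ K : Finset V, (K.sup g).degree = (K.sup f).degree := by
  obtain ⟨e, he⟩ := h
  rw [minGens_polarization, minGens_polarization] at he
  have hfI : ∀ v, f v ∈ minGens I := fun v => hf ▸ ⟨v, rfl⟩
  have hg : ∀ v, ∃ ν ∈ minGens J, polExp J ν = Finsupp.mapDomain e (polExp I (f v)) := by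
    intro v
    have : Finsupp.mapDomain e (polExp I (f v)) ∈ polExp J '' minGens J :=
      he ▸ ⟨_, ⟨_, hfI v, rfl⟩, rfl⟩
    exact this
  choose g hgJ hg using hg
  -- Polarization and renaming of variables both preserve lcms, so the match of generators extends
  -- to lcms of all subsets.
  have hsup : ∀ K : Finset V,
      polExp J (K.sup g) = Finsupp.mapDomain e (polExp I (K.sup f)) := by
    intro K
    rw [polExp_finset_sup, polExp_finset_sup, Finsupp.mapDomain_equiv_finset_sup]
    simp only [hg]
  refine ⟨g, ?_, fun v K => ?_, fun K => ?_⟩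
  · ext ν
    constructor
    · rintro ⟨v, rfl⟩
      exact hgJ v
    · intro hν
      have : polExp J ν ∈ Finsupp.mapDomain e '' (polExp I '' minGens I) := he ▸ ⟨ν, hν, rfl⟩
      obtain ⟨_, ⟨μ, hμ, rfl⟩, hμν⟩ := this
      rw [← hf] at hμ
      obtain ⟨v, rfl⟩ := hμ
      refine ⟨v, (isAntichain_minGens J).eq (hgJ v) hν ?_⟩
      rw [← polExp_le_polExp_iff (le_maxExp (hgJ v)), hg, hμν]
  · rw [← polExp_le_polExp_iff (le_maxExp (hgJ v)), hg, hsup, Finsupp.mapDomain_equiv_le_iff,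
      polExp_le_polExp_iff (le_maxExp (hfI v))]
  · have hb : ∀ i, (K.sup g) i ≤ maxExp J i := fun i => by
      rw [Finsupp.finset_sup_apply]
      exact Finset.sup_le fun v _ => le_maxExp (hgJ v) i
    have hb' : ∀ i, (K.sup f) i ≤ maxExp I i := fun i => by
      rw [Finsupp.finset_sup_apply]
      exact Finset.sup_le fun v _ => le_maxExp (hfI v) i
    rw [← degree_polExp hb, hsup, Finsupp.degree_mapDomain, degree_polExp hb']

end PolarizationTransfer

/-! ### Combinatorics of the generators of `diamondIdeal`. -/

section DiamondIdeal

/-- The exponent vectors of the generators of `diamondIdeal k m`: `Sum.inr i` stands for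
`x_{i1}^3 x_{i2}`, and `Sum.inl i` for `x_{i1}^2 x_{(i+1)1} x_{(i+1)2}`. -/
noncomputable def diamondExp (m : ℕ) : Fin m ⊕ Fin m → (Fin m × Fin 2 →₀ ℕ)
  | Sum.inl i => Finsupp.single (i, 0) 2 + Finsupp.single (finRotate m i, 0) 1 +
      Finsupp.single (finRotate m i, 1) 1
  | Sum.inr i => Finsupp.single (i, 0) 3 + Finsupp.single (i, 1) 1

/-- The generators `x_{i1}^3 x_{i2}` and `x_{j1}^3 x_{j2}` are in conflict if `i` and `j` are
cyclically adjacent. -/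
def diamondConflict (m : ℕ) : Fin m ⊕ Fin m → Fin m ⊕ Fin m → Prop
  | Sum.inr i, Sum.inr j => j = finRotate m i ∨ i = finRotate m j
  | _, _ => False

variable {m : ℕ}

theorem finRotate_ne_self (hm : 2 ≤ m) (i : Fin m) : finRotate m i ≠ i := by
  obtain ⟨n, rfl⟩ : ∃ n, m = n + 2 := ⟨m - 2, by omega⟩
  intro h
  have := congrArg Fin.val h
  rw [coe_finRotate] at this
  split_ifs at this with hi
  · rw [hi] at this; simp at this
  · omega

theorem diamondIdeal_eq (k : Type*) [Field k] (m : ℕ) :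
    diamondIdeal k m = monomialSpan k (Set.range (diamondExp m)) := by
  have h : (fun μ => monomial μ (1 : k)) '' Set.range (diamondExp m) =
      Set.range (fun i => monomial (diamondExp m (Sum.inr i)) (1 : k)) ∪
      Set.range (fun i => monomial (diamondExp m (Sum.inl i)) (1 : k)) := by
    rw [← Set.range_comp, Set.union_comm, ← Set.Sum.elim_range]
    congr 1
    ext1 (i | i) <;> rfl
  rw [monomialSpan, h, diamondIdeal]
  congr 3 <;> ext1 i <;> rw [X_pow_eq_monomial] <;>
    simp only [diamondExp, X, monomial_mul, mul_one]

theorem diamondExp_inl_zero (i j : Fin m) : diamondExp m (Sum.inl i) (j, 0) =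
    (if i = j then 2 else 0) + (if finRotate m i = j then 1 else 0) := by
  simp [diamondExp, Finsupp.single_apply, -finRotate_apply]

theorem diamondExp_inl_one (i j : Fin m) : diamondExp m (Sum.inl i) (j, 1) =
    if finRotate m i = j then 1 else 0 := by
  simp [diamondExp, Finsupp.single_apply, -finRotate_apply]

theorem diamondExp_inr_zero (i j : Fin m) : diamondExp m (Sum.inr i) (j, 0) =
    if i = j then 3 else 0 := by
  simp [diamondExp, Finsupp.single_apply]

theorem diamondExp_inr_one (i j : Fin m) : diamondExp m (Sum.inr i) (j, 1) =
    if i = j then 1 else 0 := by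
  simp [diamondExp, Finsupp.single_apply]

theorem not_le_finset_sup {σ V : Type*} {f : V → σ →₀ ℕ} {v : V} {S : Finset V} (p : σ)
    (h0 : 0 < f v p) (h : ∀ u ∈ S, f u p < f v p) : ¬f v ≤ S.sup f := by
  intro hle
  have := hle p
  rw [Finsupp.finset_sup_apply] at this
  exact absurd this (not_le.2 ((Finset.sup_lt_iff h0).2 h))

/-- No other generator has exponent `3` at `x_{j1}`. Here `m ≥ 2` ensures that `i` and `i + 1`
differ, so exponents `2` and `1` do not add up. -/
theorem diamondExp_inr_not_le (hm : 2 ≤ m) (j : Fin m) (S : Finset (Fin m ⊕ Fin m))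
    (hj : Sum.inr j ∉ S) : ¬diamondExp m (Sum.inr j) ≤ S.sup (diamondExp m) := by
  refine not_le_finset_sup (j, 0) ?_ ?_
  · simp [diamondExp_inr_zero]
  · rw [diamondExp_inr_zero, if_pos rfl]
    rintro (i | i) hi
    · rw [diamondExp_inl_zero]
      have := finRotate_ne_self hm i
      split_ifs with h1 h2
      · exact absurd (h2.trans h1.symm) this
      all_goals omega
    · rw [diamondExp_inr_zero, if_neg]
      · omega
      · rintro rfl; exact hj hi

/-- If `a_j ∈ S`, look at `x_{(j+1)2}`: it occurs only in `e_j` and `a_{j+1}`, and the latter is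
excluded by conflict. If `a_j ∉ S`, look at `x_{j1}`: apart from `e_j`, only `a_j` has exponent at
least `2` there. -/
theorem diamondExp_inl_not_le (hm : 2 ≤ m) (j : Fin m) (S : Finset (Fin m ⊕ Fin m))
    (hj : Sum.inl j ∉ S) (hS : ConflictFree (diamondConflict m) S) :
    ¬diamondExp m (Sum.inl j) ≤ S.sup (diamondExp m) := by
  by_cases hjS : Sum.inr j ∈ S
  · refine not_le_finset_sup (finRotate m j, 1) ?_ ?_
    · simp [diamondExp_inl_one]
    · rw [diamondExp_inl_one, if_pos rfl]
      rintro (i | i) hi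
      · rw [diamondExp_inl_one, if_neg]
        · omega
        · intro h
          exact hj ((finRotate m).injective h ▸ hi)
      · rw [diamondExp_inr_one, if_neg]
        · omega
        · intro h
          exact hS _ hjS _ hi (Or.inl h)
  · have hne := finRotate_ne_self hm j
    refine not_le_finset_sup (j, 0) ?_ ?_
    · simp [diamondExp_inl_zero]
    · rw [diamondExp_inl_zero, if_pos rfl, if_neg hne]
      rintro (i | i) hi
      · rw [diamondExp_inl_zero, if_neg]
        · split_ifs <;> omega
        · rintro rfl; exact hj hi
      · rw [diamondExp_inr_zero, if_neg]
        · omega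
        · rintro rfl; exact hjS hi

theorem diamondExp_inl_le (hm : 2 ≤ m) (i : Fin m) : diamondExp m (Sum.inl i) ≤
    diamondExp m (Sum.inr i) ⊔ diamondExp m (Sum.inr (finRotate m i)) := by
  have hne := finRotate_ne_self hm i
  rintro ⟨j, t⟩
  rw [Finsupp.sup_apply]
  fin_cases t
  · simp only [Fin.zero_eta, diamondExp_inl_zero, diamondExp_inr_zero]
    split_ifs with h1 h2
    · exact absurd (h2.trans h1.symm) hne
    all_goals simp
  · simp only [Fin.mk_one, diamondExp_inl_one, diamondExp_inr_one]
    split_ifs <;> simp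

theorem conflictFree_singleton (v : Fin m ⊕ Fin m) (hm : 2 ≤ m) :
    ConflictFree (diamondConflict m) {v} := by
  intro x hx y hy
  rw [Finset.mem_singleton.1 hx, Finset.mem_singleton.1 hy]
  rcases v with i | i
  · exact id
  · rintro (h | h) <;> exact finRotate_ne_self hm i h.symm

theorem eq_of_diamondExp_le (hm : 2 ≤ m) {u v : Fin m ⊕ Fin m}
    (h : diamondExp m u ≤ diamondExp m v) : u = v := by
  by_contra hne
  have h' : diamondExp m u ≤ ({v} : Finset _).sup (diamondExp m) := by rwa [Finset.sup_singleton]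
  have hmem : u ∉ ({v} : Finset (Fin m ⊕ Fin m)) := by simpa using hne
  rcases u with j | j
  · exact diamondExp_inl_not_le hm j _ hmem (conflictFree_singleton v hm) h'
  · exact diamondExp_inr_not_le hm j _ hmem h'

theorem minGens_diamondIdeal (k : Type*) [Field k] (hm : 2 ≤ m) :
    minGens (diamondIdeal k m) = Set.range (diamondExp m) := by
  rw [diamondIdeal_eq]
  refine minGens_monomialSpan ?_
  rintro _ ⟨u, rfl⟩ _ ⟨v, rfl⟩ hne hle
  exact hne (by rw [eq_of_diamondExp_le hm hle])

/-- The order of the generators: first the `x_{i1}^2 x_{(i+1)1} x_{(i+1)2}`, then the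
`x_{i1}^3 x_{i2}`. -/
def diamondOrder (m : ℕ) : List (Fin m ⊕ Fin m) :=
  (List.finRange m).map Sum.inl ++ (List.finRange m).map Sum.inr

theorem mem_diamondOrder (v : Fin m ⊕ Fin m) : v ∈ diamondOrder m := by
  rcases v with i | i <;> simp [diamondOrder]

theorem nodup_diamondOrder : (diamondOrder m).Nodup := by
  rw [diamondOrder, List.nodup_append]
  refine ⟨(List.nodup_finRange m).map Sum.inl_injective,
    (List.nodup_finRange m).map Sum.inr_injective, ?_⟩
  intro a ha b hb
  simp only [List.mem_map] at ha hb
  obtain ⟨i, -, rfl⟩ := ha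
  obtain ⟨j, -, rfl⟩ := hb
  exact Sum.inl_ne_inr

/-- What the order is needed for: before an `e` there is nothing with conflicts, and before an `a`
every `e` is already available to resolve a conflict. -/
theorem diamondOrder_prefix {pre : List (Fin m ⊕ Fin m)} {v : Fin m ⊕ Fin m}
    (h : pre ++ [v] <+: diamondOrder m) :
    (∀ j, v = Sum.inl j → ∀ u ∈ pre, ∃ i, u = Sum.inl i) ∧
    (∀ j, v = Sum.inr j → ∀ i, Sum.inl i ∈ pre) := by
  obtain ⟨post, hpost⟩ := h
  rw [diamondOrder, List.append_assoc, List.singleton_append] at hpost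
  have hl : ∀ u ∈ (List.finRange m).map (Sum.inl : Fin m → Fin m ⊕ Fin m), ∃ i, u = Sum.inl i := by
    intro u hu
    obtain ⟨i, -, rfl⟩ := List.mem_map.1 hu
    exact ⟨i, rfl⟩
  have hr : ∀ u ∈ (List.finRange m).map (Sum.inr : Fin m → Fin m ⊕ Fin m), ∃ i, u = Sum.inr i := by
    intro u hu
    obtain ⟨i, -, rfl⟩ := List.mem_map.1 hu
    exact ⟨i, rfl⟩
  rcases List.append_eq_append_iff.1 hpost with ⟨a, ha, hb⟩ | ⟨a, ha, hb⟩
  · have hpre : ∀ u ∈ pre, ∃ i, u = Sum.inl i := fun u hu => hl u (by rw [ha]; simp [hu])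
    refine ⟨fun _ _ => hpre, ?_⟩
    rintro j rfl i
    cases a with
    | nil =>
      rw [List.append_nil] at ha
      rw [← ha]
      simp
    | cons w a =>
      rw [List.cons_append, List.cons.injEq] at hb
      obtain ⟨i', hi'⟩ := hl w (by rw [ha]; simp)
      rw [← hb.1] at hi'
      exact absurd hi' Sum.inr_ne_inl
  · constructor
    · rintro j rfl
      obtain ⟨i', hi'⟩ := hr (Sum.inl j) (by rw [hb]; simp)
      exact absurd hi' Sum.inl_ne_inr
    · intro _ _ i
      rw [ha]
      simp

/-- The order of the generators satisfies the conditions for minimal iterated mapping cones, for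
every family of monomials with the same lcm lattice. -/
theorem isConeOrder_diamondOrder {σ : Type*} (hm : 2 ≤ m) (g : Fin m ⊕ Fin m → σ →₀ ℕ)
    (hg : ∀ v K, g v ≤ Finset.sup K g ↔ diamondExp m v ≤ K.sup (diamondExp m)) :
    IsConeOrder g (diamondConflict m) (diamondOrder m) := by
  classical
  have hsymm : ∀ x y, diamondConflict m x y → diamondConflict m y x := by
    rintro (i | i) (j | j) h
    · exact h
    · exact h
    · exact h
    · exact h.symm
  refine ⟨nodup_diamondOrder, hsymm, ?_, ?_, ?_, ?_⟩
  · exact fun x => conflictFree_singleton x hm x (by simp) x (by simp)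
  · intro pre v hpre K hK hdisj
    rw [← Finset.sup_union, hg]
    have hv : v ∉ K ∪ pre.toFinset := by
      intro h
      rcases Finset.mem_union.1 h with h | h
      · exact hdisj v h (by simp)
      · have := nodup_diamondOrder.sublist hpre.sublist
        rw [List.nodup_append] at this
        exact this.2.2 v (by simpa using h) v (by simp) rfl
    rcases v with j | j
    · refine diamondExp_inl_not_le hm j _ hv ?_
      have hpl := (diamondOrder_prefix hpre).1 j rfl
      intro x hx y hy hxy
      rcases Finset.mem_union.1 hx with hxK | hxp
      · rcases Finset.mem_union.1 hy with hyK | hyp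
        · exact hK x (by simp [hxK]) y (by simp [hyK]) hxy
        · obtain ⟨i, rfl⟩ := hpl y (by simpa using hyp)
          exact (hsymm _ _ hxy).elim
      · obtain ⟨i, rfl⟩ := hpl x (by simpa using hxp)
        exact hxy.elim
    · exact diamondExp_inr_not_le hm j _ hv
  · intro u v K huv huK hu hv
    have : K.sup g ⊔ g v = (insert v K).sup g := by rw [Finset.sup_insert, sup_comm]
    rw [this, hg]
    have hmem : u ∉ insert v K := by simp [huv, huK]
    rcases u with j | j
    · exact diamondExp_inl_not_le hm j _ hmem hv
    · exact diamondExp_inr_not_le hm j _ hmem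
  · intro pre v hpre u hu huv
    have hle : ∀ i, g (Sum.inl i) ≤ g (Sum.inr i) ⊔ g (Sum.inr (finRotate m i)) := by
      intro i
      have := (hg (Sum.inl i) {Sum.inr i, Sum.inr (finRotate m i)}).2 (by
        simpa using diamondExp_inl_le hm i)
      simpa using this
    rcases u with i | i <;> rcases v with j | j
    · exact huv.elim
    · exact huv.elim
    · exact huv.elim
    · have hall := (diamondOrder_prefix hpre).2 j rfl
      rcases huv with rfl | rfl
      · exact ⟨Sum.inl i, hall i, fun x => id, hle i⟩
      · exact ⟨Sum.inl j, hall j, fun x => id, (hle j).trans_eq (sup_comm _ _)⟩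

theorem finset_card_eq_sum_ite (T : Finset (Fin m ⊕ Fin m)) :
    T.card = ∑ j, ((if Sum.inr j ∈ T then 1 else 0) + if Sum.inl j ∈ T then 1 else 0) := by
  rw [Finset.sum_add_distrib, add_comm, ← Fintype.sum_sum_type
    (fun v : Fin m ⊕ Fin m => if v ∈ T then 1 else 0)]
  simp

/-- The number of cyclically pairwise nonadjacent indices is at most `m / 2`. -/
theorem ConflictFree.card_le {T : Finset (Fin m ⊕ Fin m)}
    (hT : ConflictFree (diamondConflict m) T) : T.card ≤ m / 2 + m := by
  rw [finset_card_eq_sum_ite, Finset.sum_add_distrib]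
  refine add_le_add ?_ ?_
  -- Double the count and shift one copy cyclically: each pair `j`, `j + 1` then contributes at most
  -- one.
  · rw [Nat.le_div_iff_mul_le two_pos, mul_two]
    nth_rewrite 2 [← Equiv.sum_comp (finRotate m)]
    rw [← Finset.sum_add_distrib]
    calc _ ≤ ∑ _j : Fin m, 1 := by
          refine Finset.sum_le_sum fun j _ => ?_
          have : Sum.inr j ∈ T → Sum.inr (finRotate m j) ∉ T :=
            fun h1 h2 => hT _ h1 _ h2 (Or.inl rfl)
          split_ifs <;> simp_all
      _ = m := by simp
  · calc _ ≤ ∑ _j : Fin m, 1 := Finset.sum_le_sum fun j _ => by split_ifs <;> simp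
      _ = m := by simp

/-- Take all `e`'s and the `a`'s with index `2t`, `2t + 1 < m`. The successor of such an index is
odd, and for odd `m` the last index is left out, so the cyclic wrap causes no conflict. -/
theorem exists_conflictFree_card_eq (hm : 2 ≤ m) : ∃ T : Finset (Fin m ⊕ Fin m),
    ConflictFree (diamondConflict m) T ∧ T.card = m / 2 + m := by
  classical
  have hlt : ∀ t : Fin (m / 2), 2 * (t : ℕ) + 1 < m := fun t => by have := t.2; omega
  have hrot : ∀ t : Fin (m / 2), ((finRotate m ⟨2 * t, by have := hlt t; omega⟩ : Fin m) : ℕ) =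
      2 * t + 1 := by
    intro t
    have := hlt t
    obtain ⟨n, rfl⟩ : ∃ n, m = n + 1 := ⟨m - 1, by omega⟩
    rw [finRotate_of_lt (by omega)]
  let e : Fin (m / 2) ⊕ Fin m → Fin m ⊕ Fin m :=
    Sum.elim (fun t => Sum.inr ⟨2 * t, by have := hlt t; omega⟩) Sum.inl
  have he : Function.Injective e := by
    rintro (s | s) (t | t) h
    · have : 2 * (s : ℕ) = 2 * t := congrArg Fin.val (Sum.inr_injective h)
      rw [show s = t from Fin.ext (by omega)]
    · exact absurd h Sum.inr_ne_inl
    · exact absurd h Sum.inl_ne_inr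
    · rw [Sum.inl_injective h]
  refine ⟨Finset.univ.map ⟨e, he⟩, ?_, by simp⟩
  intro x hx y hy hxy
  simp only [Finset.mem_map, Finset.mem_univ, true_and, Function.Embedding.coeFn_mk] at hx hy
  obtain ⟨s | s, rfl⟩ := hx <;> obtain ⟨t | t, rfl⟩ := hy
  · rcases hxy with h | h
    · have := (congrArg Fin.val h).trans (hrot s)
      simp only at this
      omega
    · have := (congrArg Fin.val h).trans (hrot t)
      simp only at this
      omega
  all_goals exact hxy

/-- Grouping `x_{j1}` with `x_{(j+1)2}` lets the degree be compared with membership of `a_j` and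
`e_j` one index at a time. -/
theorem degree_eq_sum_finRotate (μ : Fin m × Fin 2 →₀ ℕ) :
    μ.degree = ∑ j, (μ (j, 0) + μ (finRotate m j, 1)) := by
  rw [Finsupp.degree_eq_sum, Fintype.sum_prod_type]
  simp only [Fin.sum_univ_two, Finset.sum_add_distrib]
  rw [Equiv.sum_comp (finRotate m) fun j => μ (j, 1)]

/-- For each `j` the exponents at `x_{j1}` and `x_{(j+1)2}` add up to at most `2` plus the number of
`a_j`, `e_j` in `T`. The bounds are `3 + 1` with both, `3 + 0` with `a_j` only (conflict excludes
`a_{j+1}`), `2 + 1` with `e_j` only, and `1 + 1` with neither. -/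
theorem ConflictFree.degree_sup_le (hm : 2 ≤ m) {T : Finset (Fin m ⊕ Fin m)}
    (hT : ConflictFree (diamondConflict m) T) :
    (T.sup (diamondExp m)).degree ≤ 2 * m + T.card := by
  have hm2 : 2 * m = ∑ _j : Fin m, 2 := by simp [mul_comm]
  rw [degree_eq_sum_finRotate, finset_card_eq_sum_ite, hm2, ← Finset.sum_add_distrib]
  refine Finset.sum_le_sum fun j _ => ?_
  rw [Finsupp.finset_sup_apply, Finsupp.finset_sup_apply]
  have hzero : ∀ n, (∀ v ∈ T, diamondExp m v (j, 0) ≤ n) →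
      (T.sup fun v => diamondExp m v (j, 0)) ≤ n := fun n h => Finset.sup_le h
  have hone : ∀ n, (∀ v ∈ T, diamondExp m v (finRotate m j, 1) ≤ n) →
      (T.sup fun v => diamondExp m v (finRotate m j, 1)) ≤ n := fun n h => Finset.sup_le h
  have hrot : ∀ i : Fin m, finRotate m i ≠ i := finRotate_ne_self hm
  have h1 : (T.sup fun v => diamondExp m v (finRotate m j, 1)) ≤ 1 := by
    refine hone 1 ?_
    rintro (i | i) -
    · rw [diamondExp_inl_one]; split_ifs <;> omega
    · rw [diamondExp_inr_one]; split_ifs <;> omega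
  by_cases hr : Sum.inr j ∈ T
  · have h0 : (T.sup fun v => diamondExp m v (j, 0)) ≤ 3 := by
      refine hzero 3 ?_
      rintro (i | i) -
      · rw [diamondExp_inl_zero]; split_ifs <;> omega
      · rw [diamondExp_inr_zero]; split_ifs <;> omega
    by_cases hl : Sum.inl j ∈ T
    · simp only [hr, hl, if_true]
      omega
    · have h1 : (T.sup fun v => diamondExp m v (finRotate m j, 1)) ≤ 0 := by
        refine hone 0 ?_
        rintro (i | i) hi
        · rw [diamondExp_inl_one, if_neg]
          intro h
          exact hl ((finRotate m).injective h ▸ hi)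
        · rw [diamondExp_inr_one, if_neg]
          intro h
          exact hT _ hr _ hi (Or.inl h)
      simp only [hr, hl, if_true, if_false]
      omega
  · by_cases hl : Sum.inl j ∈ T
    · have h0 : (T.sup fun v => diamondExp m v (j, 0)) ≤ 2 := by
        refine hzero 2 ?_
        rintro (i | i) hi
        · rw [diamondExp_inl_zero]
          split_ifs with h1 h2
          · exact absurd (h2.trans h1.symm) (hrot i)
          all_goals omega
        · rw [diamondExp_inr_zero, if_neg]
          · omega
          · rintro rfl; exact hr hi
      simp only [hr, hl, if_true, if_false]
      omega
    · have h0 : (T.sup fun v => diamondExp m v (j, 0)) ≤ 1 := by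
        refine hzero 1 ?_
        rintro (i | i) hi
        · rw [diamondExp_inl_zero, if_neg]
          · split_ifs <;> omega
          · rintro rfl; exact hl hi
        · rw [diamondExp_inr_zero, if_neg]
          · omega
          · rintro rfl; exact hr hi
      simp only [hr, hl, if_false]
      omega

/-- The lcm of all the `e`'s is the product of the `x_{j1}^2 x_{j2}`, of degree `3m`. -/
theorem exists_conflictFree_degree_eq (hm : 2 ≤ m) : ∃ T : Finset (Fin m ⊕ Fin m),
    ConflictFree (diamondConflict m) T ∧ T.card = m ∧
      (T.sup (diamondExp m)).degree = 2 * m + T.card := by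
  have hT : ConflictFree (diamondConflict m)
      (Finset.univ.map ⟨(Sum.inl : Fin m → Fin m ⊕ Fin m), Sum.inl_injective⟩) := by
    intro x hx y hy hxy
    obtain ⟨i, -, rfl⟩ := Finset.mem_map.1 hx
    exact hxy
  refine ⟨_, hT, by simp, le_antisymm (hT.degree_sup_le hm) ?_⟩
  have h3 : 2 * m + (Finset.univ.map
      ⟨(Sum.inl : Fin m → Fin m ⊕ Fin m), Sum.inl_injective⟩).card = ∑ _j : Fin m, 3 := by
    simp; omega
  rw [h3, degree_eq_sum_finRotate]
  refine Finset.sum_le_sum fun j _ => ?_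
  have hle : diamondExp m (Sum.inl j) ≤ (Finset.univ.map
      ⟨(Sum.inl : Fin m → Fin m ⊕ Fin m), Sum.inl_injective⟩).sup (diamondExp m) :=
    Finset.le_sup (by simp)
  refine le_trans ?_ (add_le_add (hle (j, 0)) (hle (finRotate m j, 1)))
  rw [diamondExp_inl_zero, diamondExp_inl_one]
  simp only [if_true]
  omega

end DiamondIdeal

/-! ### From a resolution of `J` to one of `S ⧸ J`. -/

section Quotient

variable {k : Type*} [Field k] {σ : Type*}

theorem coeff_homPart (a b ν : σ →₀ ℕ) (p : MvPolynomial σ k) [Decidable (ν + a = b)] :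
    coeff ν (homPart a b p) = if ν + a = b then coeff ν p else 0 := by
  classical
  by_cases hab : a ≤ b
  · have : ν + a = b ↔ b - a = ν := by
      constructor
      · rintro rfl; simp
      · rintro rfl; exact tsub_add_cancel_of_le hab
    simp only [homPart, hab, if_true, this]
    simp only [AddMonoidHom.comp_apply, LinearMap.toAddMonoidHom_coe, coeff_monomial,
      coeffAddMonoidHom_apply]
    split_ifs with h
    · rw [h]
    · rfl
  · have : ν + a ≠ b := by rintro rfl; simp at hab
    simp [homPart, hab, this]

theorem IsMonomialIdeal.homPart_mem {J : Ideal (MvPolynomial σ k)} (hJ : IsMonomialIdeal J)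
    {p : MvPolynomial σ k} (hp : p ∈ J) (a b : σ →₀ ℕ) : homPart a b p ∈ J := by
  classical
  obtain ⟨A, rfl⟩ := hJ
  rw [mem_monomialSpan] at hp ⊢
  intro ν hν
  apply hp
  rw [mem_support_iff, coeff_homPart] at hν
  rw [mem_support_iff]
  exact fun h => hν (by simp [h])

theorem smul_one_quotient (J : Ideal (MvPolynomial σ k)) (p : MvPolynomial σ k) :
    p • (1 : MvPolynomial σ k ⧸ J) = Ideal.Quotient.mk J p :=
  congrArg (Ideal.Quotient.mk J) (mul_one p)

theorem hasHomogeneousProjections_quotGrading {J : Ideal (MvPolynomial σ k)}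
    (hJ : IsMonomialIdeal J) : HasHomogeneousProjections (k := k) (quotGrading J) := by
  -- A monomial ideal contains the homogeneous parts of its elements, so the projection does not
  -- depend on the representative.
  have hout : ∀ μ p, Ideal.Quotient.mk J (homPart 0 μ (Ideal.Quotient.mk J p).out) =
      Ideal.Quotient.mk J (homPart 0 μ p) := by
    intro μ p
    rw [Ideal.Quotient.eq, ← map_sub]
    apply hJ.homPart_mem
    rw [← Ideal.Quotient.eq]
    exact Quotient.out_eq _
  let π : (σ →₀ ℕ) → (MvPolynomial σ k ⧸ J) →+ (MvPolynomial σ k ⧸ J) := fun μ =>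
    AddMonoidHom.mk' (fun x => Ideal.Quotient.mk J (homPart 0 μ x.out)) (by
      intro x y
      obtain ⟨p, rfl⟩ := Ideal.Quotient.mk_surjective x
      obtain ⟨q, rfl⟩ := Ideal.Quotient.mk_surjective y
      rw [← map_add, hout, hout, hout, ← map_add, ← map_add])
  refine ⟨π, ?_⟩
  rintro μ ν r c _ ⟨_, ⟨y, rfl⟩, rfl⟩
  have hsmul : (monomial r c : MvPolynomial σ k) • Ideal.Quotient.mk J (monomial ν y) =
      Ideal.Quotient.mk J (monomial (r + ν) (c * y)) := by
    rw [← monomial_mul]; rfl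
  have hπ : π μ ((monomial r c : MvPolynomial σ k) • Ideal.Quotient.mk J (monomial ν y)) =
      Ideal.Quotient.mk J (homPart 0 μ (monomial (r + ν) (c * y))) := by
    rw [hsmul]
    exact hout μ _
  constructor
  · intro h
    refine hπ.trans ?_
    rw [homPart_monomial_of_eq _ (by simpa using h)]
    exact hsmul.symm
  · intro h
    refine hπ.trans ?_
    rw [homPart_monomial_of_ne _ (by simpa using h), map_zero]

namespace AugFreeComplex

variable {J : Ideal (MvPolynomial σ k)} (F : AugFreeComplex k σ (polyGrading k σ))

/-- The index sets of `quotientComplex`. -/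
def quotB : ℕ → Type
  | 0 => Unit
  | i + 1 => F.B i

instance quotFintype : ∀ i, Fintype (F.quotB i)
  | 0 => inferInstanceAs (Fintype Unit)
  | i + 1 => inferInstanceAs (Fintype (F.B i))

/-- The multidegrees of `quotientComplex`. -/
def quotDeg : ∀ i, F.quotB i → (σ →₀ ℕ)
  | 0 => fun _ => 0
  | i + 1 => F.deg i

/-- The differentials of `quotientComplex`. -/
noncomputable def quotD : ∀ i, Matrix (F.quotB i) (F.quotB (i + 1)) (MvPolynomial σ k)
  | 0 => Matrix.of fun _ b => F.ε b
  | i + 1 => F.D i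

theorem multiHom_ε (b : F.B 0) : MultiHom (F.ε b) 0 (F.deg 0 b) := by
  obtain ⟨c, hc⟩ := F.ε_hom b
  rw [← hc]
  exact multiHom_monomial _ (add_zero _)

/-- The complex `⋯ → F_1 → F_0 → S → S ⧸ J` for a complex `⋯ → F_1 → F_0 → J`. -/
noncomputable def quotientComplex (hF : ∀ b, F.ε b ∈ J) :
    AugFreeComplex k σ (quotGrading J) where
  B := F.quotB
  fin := F.quotFintype
  deg := F.quotDeg
  D := F.quotD
  ε := fun _ => 1
  D_hom := by
    rintro (_ | i) a b
    · exact F.multiHom_ε b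
    · exact F.D_hom i a b
  ε_hom := fun _ => ⟨1, ⟨1, rfl⟩, rfl⟩
  D_comp := by
    rintro (_ | i)
    · ext1 a b
      have h := F.ε_comp b
      simp only [smul_eq_mul] at h
      refine Eq.trans ?_ h
      exact Finset.sum_congr rfl fun c _ => mul_comm _ _
    · exact F.D_comp i
  ε_comp := by
    intro b
    refine (Fintype.sum_unique (ι := Unit) _).trans ?_
    exact (smul_one_quotient J _).trans (Ideal.Quotient.eq_zero_iff_mem.2 (hF b))

theorem quotientComplex_resolves (hF : ∀ b, F.ε b ∈ J) (h : F.Resolves J) :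
    (F.quotientComplex hF).Resolves (⊤ : Submodule (MvPolynomial σ k) (MvPolynomial σ k ⧸ J)) := by
  obtain ⟨hspan, hex0, hex⟩ := h
  refine ⟨?_, ?_, ?_⟩
  · rw [eq_top_iff]
    rintro x -
    obtain ⟨p, rfl⟩ := Ideal.Quotient.mk_surjective x
    rw [← smul_one_quotient]
    exact Submodule.smul_mem _ _ (Submodule.subset_span ⟨(), rfl⟩)
  · intro v hv
    have hv' : v () ∈ J := by
      have := (Fintype.sum_unique (ι := Unit) _).symm.trans hv
      exact Ideal.Quotient.eq_zero_iff_mem.1 ((smul_one_quotient J _).symm.trans this)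
    rw [← hspan] at hv'
    obtain ⟨w, hw⟩ := (Submodule.mem_span_range_iff_exists_fun _).1 hv'
    refine ⟨w, ?_⟩
    ext1 a
    refine hw.symm.trans ?_
    exact Finset.sum_congr rfl fun c _ => mul_comm _ _
  · rintro (_ | i) v hv
    · refine hex0 v ?_
      refine Eq.trans ?_ (congrFun hv ())
      exact Finset.sum_congr rfl fun c _ => mul_comm _ _
    · exact hex i v hv

theorem quotientComplex_isMinimal (hF : ∀ b, F.ε b ∈ J) (h : F.IsMinimal)
    (h0 : ∀ b, F.deg 0 b ≠ 0) : (F.quotientComplex hF).IsMinimal := by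
  rintro (_ | i) a b
  · exact (F.multiHom_ε b).mem_span_X (h0 b).symm
  · exact h i a b

end AugFreeComplex

end Quotient

/-! ### Projective dimension from a minimal resolution. -/

section ProjectiveDimension

open CategoryTheory

universe u w

theorem LinearMap.hasProjectiveDimensionLT_ker_iff {R : Type u} [Ring R] {M N : Type w}
    [AddCommGroup M] [Module R M] [AddCommGroup N] [Module R N] [Module.Projective R M]
    (f : M →ₗ[R] N) (hf : Function.Surjective f) (j : ℕ) :
    HasProjectiveDimensionLT (ModuleCat.of R N) (j + 2) ↔
      HasProjectiveDimensionLT (ModuleCat.of R (LinearMap.ker f)) (j + 1) :=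
  (LinearMap.shortExact_shortComplexKer hf).hasProjectiveDimensionLT_X₃_iff j
    (ModuleCat.projective_of_categoryTheory_projective (ModuleCat.of R M))

namespace AugFreeComplex

variable {k : Type*} [Field k] {σ : Type*} {J : Ideal (MvPolynomial σ k)}
  (F : AugFreeComplex k σ (polyGrading k σ))

/-- The augmentation as a linear map. -/
noncomputable def augmentation : (F.B 0 → MvPolynomial σ k) →ₗ[MvPolynomial σ k] MvPolynomial σ k :=
  Fintype.linearCombination (MvPolynomial σ k) F.ε

theorem augmentation_apply (v : F.B 0 → MvPolynomial σ k) :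
    F.augmentation v = ∑ a, v a • F.ε a := rfl

/-- The kernels in the augmented complex. -/
noncomputable def syzygies : ∀ i, Submodule (MvPolynomial σ k) (F.B i → MvPolynomial σ k)
  | 0 => LinearMap.ker F.augmentation
  | i + 1 => LinearMap.ker (F.D i).mulVecLin

theorem Resolves.mem_syzygies_iff {F : AugFreeComplex k σ (polyGrading k σ)} (hF : F.Resolves J)
    (i : ℕ) (v : F.B i → MvPolynomial σ k) :
    v ∈ F.syzygies i ↔ ∃ w, (F.D i).mulVecLin w = v := by
  obtain ⟨-, hex0, hex⟩ := hF
  cases i with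
  | zero =>
    constructor
    · intro hv
      obtain ⟨w, hw⟩ := hex0 v hv
      exact ⟨w, hw.symm⟩
    · rintro ⟨w, rfl⟩
      change F.augmentation _ = 0
      simp only [augmentation_apply, Matrix.mulVecLin_apply, Matrix.mulVec, dotProduct,
        Finset.sum_smul]
      rw [Finset.sum_comm]
      refine Finset.sum_eq_zero fun b _ => ?_
      have := congrArg (w b * ·) (F.ε_comp b)
      simp only [mul_zero, Finset.mul_sum] at this
      rw [← this]
      refine Finset.sum_congr rfl fun a _ => ?_
      simp only [smul_eq_mul]
      ring
  | succ i =>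
    constructor
    · intro hv
      obtain ⟨w, hw⟩ := hex i v hv
      exact ⟨w, hw.symm⟩
    · rintro ⟨w, rfl⟩
      change (F.D i).mulVec ((F.D (i + 1)).mulVec w) = 0
      rw [Matrix.mulVec_mulVec, F.D_comp, Matrix.zero_mulVec]

variable {F}

theorem Resolves.exists_surjective_zero (hF : F.Resolves J) :
    ∃ p : (F.B 0 → MvPolynomial σ k) →ₗ[MvPolynomial σ k] J,
      Function.Surjective p ∧ LinearMap.ker p = F.syzygies 0 := by
  have hrange : LinearMap.range F.augmentation = J := by
    rw [← hF.1]
    exact Fintype.range_linearCombination _ _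
  refine ⟨F.augmentation.codRestrict J fun v => hrange.le ⟨v, rfl⟩, ?_, ?_⟩
  · rintro ⟨x, hx⟩
    obtain ⟨v, hv⟩ := hrange.ge hx
    exact ⟨v, Subtype.ext hv⟩
  · exact LinearMap.ker_codRestrict _ _ _

theorem Resolves.exists_surjective_succ (hF : F.Resolves J) (i : ℕ) :
    ∃ p : (F.B (i + 1) → MvPolynomial σ k) →ₗ[MvPolynomial σ k] F.syzygies i,
      Function.Surjective p ∧ LinearMap.ker p = F.syzygies (i + 1) := by
  refine ⟨(F.D i).mulVecLin.codRestrict _ fun v => (hF.mem_syzygies_iff i _).2 ⟨v, rfl⟩, ?_, ?_⟩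
  · rintro ⟨x, hx⟩
    obtain ⟨v, hv⟩ := (hF.mem_syzygies_iff i _).1 hx
    exact ⟨v, Subtype.ext hv⟩
  · exact LinearMap.ker_codRestrict _ _ _

/-- Dimension shifting along the short exact sequences of syzygies, `i + 1` times. -/
theorem Resolves.hasProjectiveDimensionLT_iff (hF : F.Resolves J) (i j : ℕ) :
    HasProjectiveDimensionLT (ModuleCat.of (MvPolynomial σ k) J) (i + j + 2) ↔
      HasProjectiveDimensionLT (ModuleCat.of (MvPolynomial σ k) (F.syzygies i)) (j + 1) := by
  induction i generalizing j with
  | zero =>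
    obtain ⟨p, hp, hker⟩ := hF.exists_surjective_zero
    rw [← hker, ← p.hasProjectiveDimensionLT_ker_iff hp, zero_add]
  | succ i ih =>
    obtain ⟨p, hp, hker⟩ := hF.exists_surjective_succ i
    rw [← hker, ← p.hasProjectiveDimensionLT_ker_iff hp, ← ih (j + 1)]
    rw [show i + 1 + j + 2 = i + (j + 1) + 2 by omega]

/-- In a minimal resolution whose last module is `F_{n+1} ≠ 0`, the cokernel of `F_{n+1} → F_n` is
not projective. -/
theorem IsMinimal.not_projective (hmin : F.IsMinimal) (hF : F.Resolves J) {n : ℕ} {N : Type*}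
    [AddCommGroup N] [Module (MvPolynomial σ k) N]
    (p : (F.B n → MvPolynomial σ k) →ₗ[MvPolynomial σ k] N) (hp : Function.Surjective p)
    (hker : LinearMap.ker p = F.syzygies n) [IsEmpty (F.B (n + 2))] [Nonempty (F.B (n + 1))] :
    ¬Module.Projective (MvPolynomial σ k) N := by
  classical
  intro hproj
  obtain ⟨s, hs⟩ := Module.projective_lifting_property p LinearMap.id hp
  have hs' : ∀ x, p (s x) = x := fun x => LinearMap.congr_fun hs x
  have hr : ∀ x, ∃ w, (F.D n).mulVecLin w = x - s (p x) := by
    intro x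
    rw [← hF.mem_syzygies_iff, ← hker, LinearMap.mem_ker, map_sub, hs', sub_self]
  choose w hw using hr
  have hinj : ∀ x, (F.D n).mulVecLin x = 0 → x = 0 := by
    intro x hx
    obtain ⟨y, rfl⟩ := hF.2.2 n x hx
    rw [Subsingleton.elim y 0, Matrix.mulVec_zero]
  obtain ⟨b⟩ := ‹Nonempty (F.B (n + 1))›
  have hpD : p ((F.D n).mulVecLin (Pi.single b 1)) = 0 := by
    rw [← LinearMap.mem_ker, hker, hF.mem_syzygies_iff]
    exact ⟨_, rfl⟩
  -- A splitting `s` makes `x - s (p x)` a boundary `D (w x)`. Since `D` is injective, the basis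
  -- vector at `b` is the combination of the `w (e_a)` with coefficients from column `b` of `D`.
  -- These lie in the ideal of the variables, hence so would `1`.
  have key : Pi.single b 1 - ∑ a, F.D n a b • w (Pi.single a 1) = 0 := by
    apply hinj
    have h1 : (F.D n).mulVecLin (Pi.single b 1) = ∑ a, F.D n a b • Pi.single a 1 := by
      ext1 c
      simp [Finset.sum_apply, Pi.single_apply]
    rw [map_sub, map_sum]
    simp only [map_smul, hw, smul_sub, Finset.sum_sub_distrib]
    simp only [← map_smul]
    rw [← map_sum s, ← map_sum p, ← h1, hpD, map_zero, sub_zero, sub_self]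
  have hb := congrFun key b
  simp only [Pi.sub_apply, Pi.single_eq_same, Finset.sum_apply, Pi.smul_apply, smul_eq_mul,
    Pi.zero_apply] at hb
  have hmem : (1 : MvPolynomial σ k) ∈ Ideal.span (Set.range (X : σ → MvPolynomial σ k)) := by
    rw [sub_eq_zero.1 hb]
    exact Ideal.sum_mem _ fun a _ => Ideal.mul_mem_right _ _ (hmin n a b)
  simpa using coeff_zero_of_mem_span_X hmem

/-- The projective dimension is the length of a minimal resolution. -/
theorem Resolves.projectiveDimension_eq (hF : F.Resolves J) (hmin : F.IsMinimal) (n : ℕ)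
    [IsEmpty (F.B (n + 2))] [Nonempty (F.B (n + 1))] :
    projectiveDimension (ModuleCat.of (MvPolynomial σ k) J) = ((n + 1 : ℕ) : WithBot ℕ∞) := by
  apply le_antisymm
  · rw [projectiveDimension_le_iff]
    refine (hF.hasProjectiveDimensionLT_iff n 0).2 ?_
    rw [zero_add, ← projective_iff_hasProjectiveDimensionLT_one, ← IsProjective.iff_projective]
    obtain ⟨p, hp, hker⟩ := hF.exists_surjective_succ n
    have hinj : Function.Injective p := by
      rw [← LinearMap.ker_eq_bot, hker, eq_bot_iff]
      intro x hx
      obtain ⟨y, rfl⟩ := (hF.mem_syzygies_iff _ _).1 hx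
      rw [Subsingleton.elim y 0, map_zero]
      exact Submodule.zero_mem _
    exact Module.Projective.of_equiv (LinearEquiv.ofBijective p ⟨hinj, hp⟩)
  · rw [projectiveDimension_ge_iff]
    intro h
    -- The cokernel of `F_{n+1} → F_n` is `J` itself for `n = 0`, and the syzygy module of index `n
    -- - 1` otherwise.
    cases n with
    | zero =>
      obtain ⟨p, hp, hker⟩ := hF.exists_surjective_zero
      refine hmin.not_projective hF p hp hker ?_
      rwa [IsProjective.iff_projective, projective_iff_hasProjectiveDimensionLT_one]
    | succ n =>
      obtain ⟨p, hp, hker⟩ := hF.exists_surjective_succ n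
      refine hmin.not_projective hF p hp hker ?_
      rw [IsProjective.iff_projective, projective_iff_hasProjectiveDimensionLT_one]
      exact (hF.hasProjectiveDimensionLT_iff n 0).1 h

end AugFreeComplex

end ProjectiveDimension

/-! ### The invariants read off from conflict-free sets. -/

theorem mainTheorem6 {k : Type*} [Field k] (m : ℕ) (hm : 2 ≤ m) {σ : Type*} [Finite σ]
    (J : Ideal (MvPolynomial σ k)) (hJ : IsMonomialIdeal J)
    (hpol : SamePolarityClass (diamondIdeal k m) J) :
    regQuotient J = 2 * (m : ℤ) ∧
    regIdeal J = 2 * (m : ℤ) + 1 ∧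
    CategoryTheory.projectiveDimension (ModuleCat.of (MvPolynomial σ k) J) =
      ((m / 2 + m - 1 : ℕ) : WithBot ℕ∞) ∧
    ∃ (L : List (σ →₀ ℕ)) (F : AugFreeComplex k σ (polyGrading k σ)),
      IsGenOrdering L J ∧ IsIteratedMappingCone L F ∧ F.Resolves J ∧ F.IsMinimal := by
  classical
  obtain ⟨g, hrange, hg, hdeg⟩ :=
    hpol.exists_transfer (diamondExp m) (minGens_diamondIdeal k hm).symm
  obtain ⟨F, hcone, hord, hres, hmin, hFdeg⟩ :=
    (isConeOrder_diamondOrder hm g hg).exists_iteratedMappingCone (k := k)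
  have hspan : monomialSpan k {μ | μ ∈ (diamondOrder m).map g} = J := by
    have : {μ | μ ∈ (diamondOrder m).map g} = minGens J := by
      rw [← hrange]
      ext μ
      simp [mem_diamondOrder, -Sum.exists]
    rw [this, monomialSpan_minGens hJ]
  rw [hspan] at hord hres
  have hFdeg' : ∀ i μ, (∃ b, F.deg i b = μ) ↔
      ∃ T, ConflictFree (diamondConflict m) T ∧ T.card = i + 1 ∧ T.sup g = μ := by
    intro i μ
    rw [hFdeg]
    refine exists_congr fun T => ⟨And.right, fun h => ⟨fun v _ => ?_, h⟩⟩
    exact List.mem_toFinset.2 (mem_diamondOrder v)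
  have hFε : ∀ b, F.ε b ∈ J := fun b => hres.1 ▸ Submodule.subset_span ⟨b, rfl⟩
  have hF0 : ∀ b, F.deg 0 b ≠ 0 := by
    intro b hb
    obtain ⟨T, -, hcard, hT⟩ := (hFdeg' 0 _).1 ⟨b, rfl⟩
    obtain ⟨v, rfl⟩ := Finset.card_eq_one.1 hcard
    rw [hb, Finset.sup_singleton] at hT
    -- A generator of degree `0` would divide all the others and hence equal two different ones.
    have h0 : diamondExp m v ≤ (∅ : Finset (Fin m ⊕ Fin m)).sup (diamondExp m) := by
      rw [← hg, hT, Finset.sup_empty]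
      exact le_rfl
    rw [Finset.sup_empty] at h0
    have h1 := eq_of_diamondExp_le hm (h0.trans (bot_le (a := diamondExp m (Sum.inl ⟨0, by omega⟩))))
    have h2 := eq_of_diamondExp_le hm (h0.trans (bot_le (a := diamondExp m (Sum.inr ⟨0, by omega⟩))))
    exact Sum.inl_ne_inr (h1.symm.trans h2)
  obtain ⟨T₀, hT₀, hT₀card, hT₀deg⟩ := exists_conflictFree_degree_eq hm
  obtain ⟨b₀, hb₀⟩ := (hFdeg' (m - 1) _).2 ⟨T₀, hT₀, by omega, rfl⟩
  have hle : ∀ i b, (F.deg i b).degree ≤ 2 * m + (i + 1) := by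
    intro i b
    obtain ⟨T, hT, hcard, hTb⟩ := (hFdeg' i _).1 ⟨b, rfl⟩
    rw [← hTb, hdeg, ← hcard]
    exact hT.degree_sup_le hm
  have hb₀deg : (F.deg (m - 1) b₀).degree = 2 * m + m := by
    rw [hb₀, hdeg, hT₀deg, hT₀card]
  have hbetti := bettiNonzero_iff hasHomogeneousProjections_polyGrading F hres hmin
  have hbettiQ := bettiNonzero_iff (hasHomogeneousProjections_quotGrading hJ)
    (F.quotientComplex hFε) (F.quotientComplex_resolves hFε hres)
    (F.quotientComplex_isMinimal hFε hmin hF0)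
  refine ⟨?_, ?_, ?_, (diamondOrder m).map g, F, hord, hcone, hres, hmin⟩
  · refine IsGreatest.csSup_eq ⟨⟨m, F.deg (m - 1) b₀, ?_, ?_⟩, ?_⟩
    · obtain ⟨n, rfl⟩ : ∃ n, m = n + 1 := ⟨m - 1, by omega⟩
      exact (hbettiQ _ _).2 ⟨b₀, rfl⟩
    · rw [hb₀deg]
      push_cast
      ring
    · rintro r ⟨i, μ, hi, rfl⟩
      obtain ⟨b, rfl⟩ := (hbettiQ _ _).1 hi
      -- Degree `0` of the quotient resolution is `S` itself, contributing `0`; above it the indices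
      -- are shifted by one, so the maximum is one less than for `J`.
      rcases i with _ | i
      · have : ((F.quotientComplex hFε).deg 0 b).degree = 0 := map_zero Finsupp.degree
        rw [this]
        push_cast
        omega
      · have := hle i b
        change ((F.deg i b).degree : ℤ) - _ ≤ _
        push_cast
        omega
  · refine IsGreatest.csSup_eq ⟨⟨m - 1, F.deg (m - 1) b₀, (hbetti _ _).2 ⟨b₀, rfl⟩, ?_⟩, ?_⟩
    · rw [hb₀deg]
      omega
    · rintro r ⟨i, μ, hi, rfl⟩
      obtain ⟨b, rfl⟩ := (hbetti _ _).1 hi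
      have := hle i b
      omega
  -- Homological degree `i` corresponds to `|T| = i + 1`, so the largest conflict-free sets sit in
  -- degree `n + 1` and degree `n + 2` is empty.
  · obtain ⟨n, hn⟩ : ∃ n, m / 2 + m - 1 = n + 1 := ⟨m / 2 + m - 2, by omega⟩
    have : IsEmpty (F.B (n + 2)) := by
      refine ⟨fun b => ?_⟩
      obtain ⟨T, hT, hcard, -⟩ := (hFdeg' _ _).1 ⟨b, rfl⟩
      have := hT.card_le
      omega
    have : Nonempty (F.B (n + 1)) := by
      obtain ⟨T, hT, hcard⟩ := exists_conflictFree_card_eq hm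
      obtain ⟨b, -⟩ := (hFdeg' (n + 1) _).2 ⟨T, hT, by omega, rfl⟩
      exact ⟨b⟩
    rw [hn]
    exact hres.projectiveDimension_eq hmin n
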